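/- **Setting.** Let $J\subset\mathbb{R}^{p}$ be compact with non-empty interior, let $n_k\ge 2$ be integers and $c_k\in(0,1)$ with $\inf_k c_k>0$ $(k\ge1)$. The Moran class $\mathcal{M}(J,\{n_k\},\{c_k\})$ consists of all sets $$E=\bigcap_{k\ge 0}\ \bigcup_{i_1\cdots i_k} J_{i_1\cdots i_k}\qquad(1\le i_t\le n_t),$$ where $J_\emptyset=J$ and, for every word $i_1\cdots i_{k-1}$ and $k\geq 1$, the sets $J_{i_1\cdots i_{k-1}1},\dots,J_{i_1\cdots i_{k-1}n_k}$ are subsets of $J_{i_1\cdots i_{k-1}}$ with pairwise disjoint interiors, each of them an image of $J_{i_1\cdots i_{k-1}}$ under a similitude of $\mathbb{R}^p$ with ratio $c_k$. Let $\mathcal{A}=\mathcal{M}(J,\{n_k\},\{c_k\})$ and let $\mathcal{B}=\mathcal{M}(I,\{m_k\},\{d_k\})$ be another such class, with $I\subset\mathbb{R}^q$. Write $|\cdot|$ for the diameter. For $c_1\cdots c_k|J|<r\le c_1\cdots c_{k-1}|J|$ with $k\ge 1$ put $\Phi_{\mathcal{A}}(r)=n_1\cdots n_k$, put $\Phi_{\mathcal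 A}(r)=1$ for $r>|J|$, and let $\Phi_{\mathcal{A}}(r,r')=\Phi_{\mathcal{A}}(r')/\Phi_{\mathcal{A}}(r)$ for $0<r'\le r$. Define $\Phi_{\mathcal{B}}$ in the same way from $I,\{m_k\},\{d_k\}$. A compact subset $A$ of a metric space is *uniformly disconnected* if there are $C>1$ and $r^*>0$ such that for all $x\in A$ and $0<r<r^*$ there is $S\subset A$ with $A\cap B(x,r)\subset S\subset B(x,Cr)$ and $\mathrm{d}(S,A\setminus S)>r$, where $B(x,r)$ is the closed ball and the distance is $+\infty$ if one of the two sets is empty. We write $X\hookrightarrow Y$ if there are an injection $f:X\to Y$ and $L\ge1$ with $\mathrm{d}(x_1,x_2)/L\le \mathrm{d}(f(x_1),f(x_2))\le L\,\mathrm{d}(x_1,x_2)$ for all $x_1,x_2\in X$. Compact metric spaces $X,Y$ are *quasi-Lipschitz equivalent* if there is a bijection $f:X\to Y$ such that $\log \mathrm{d}(f(x_1),f(x_2))/\log \mathrm{d}(x_1,x_2)\to1$ uniformly as $\mathrm{d}(x_1,x_2)\to0$, $x_1\neq x_2$. **Corollary.** 1. If for some integer $k_0\ge1$ $$\limsup_{k\to\infty}\frac{\log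 (n_{k+1}\cdots n_{k+k_0})}{-\log (c_{k+1}\cdots c_{k+k_0})}<1,$$ then every $E\in\mathcal{A}$ is uniformly disconnected. 2. If $E\in\mathcal{A}$ is uniformly disconnected and for some $r_0\in(0,1)$ $$\sup_{0<r'<r_0r<r<r_0}\ \frac{\log\Phi_{\mathcal{A}}(r,r')}{\log\Phi_{\mathcal{B}}(r,r')}<1,$$ then $E\hookrightarrow F$ for every $F\in\mathcal{B}$. (Quotients with denominator $0$ are read as $0$. Neither this convention nor the values of $\Phi_{\mathcal{A}},\Phi_{\mathcal{B}}$ at scales $r>|J|$, $r>|I|$ affects the result, since $r_0$ can be decreased.) 3. If $E\in\mathcal{A}$ and $F\in\mathcal{B}$ are uniformly disconnected, then $E$ and $F$ are quasi-Lipschitz equivalent if and only if $$\lim_{r\to0^+}\frac{\log\Phi_{\mathcal{A}}(r)}{\log\Phi_{\mathcal{B}}(r)}=1.$$ -/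

import Mathlib

open Filter Topology

noncomputable section

namespace Moran

/-- `D₁` is geometrically similar to `D₂` with ratio `r`: it is the image of `D₂` under a
similitude of the whole space with ratio `r`. -/
def GeomSimilar {X : Type*} [PseudoMetricSpace X] (r : ℝ) (D₁ D₂ : Set X) : Prop :=
  ∃ S : X → X, (∀ x y, dist (S x) (S y) = r * dist x y) ∧ D₁ = S '' D₂

/-- The standing assumptions on the parameters of a Moran class. Subdivision steps are counted
from `0`: the `(k+1)`-st step divides every basic element of order `k` into `n k` pieces of
relative size `c k`. -/
structure IsData {d : ℕ} (J : Set (EuclideanSpace ℝ (Fin d))) (n : ℕ → ℕ) (c : ℕ → ℝ) :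
    Prop where
  isCompact : IsCompact J
  interior_nonempty : (interior J).Nonempty
  two_le : ∀ k, 2 ≤ n k
  pos : ∀ k, 0 < c k
  lt_one : ∀ k, c k < 1
  iInf_pos : 0 < ⨅ k, c k

/-- Admissible words: the letter at position `t` is one of `0, …, n t - 1`. -/
def IsWord (n : ℕ → ℕ) (w : List ℕ) : Prop :=
  ∀ (t : ℕ) (ht : t < w.length), w[t] < n t

/-- `K w` (for admissible words `w`) is the family of basic elements of a Moran construction. -/
structure IsFamily {d : ℕ} (J : Set (EuclideanSpace ℝ (Fin d))) (n : ℕ → ℕ) (c : ℕ → ℝ)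
    (K : List ℕ → Set (EuclideanSpace ℝ (Fin d))) : Prop where
  root : K [] = J
  subset : ∀ w, IsWord n w → ∀ i < n w.length, K (w ++ [i]) ⊆ K w
  similar : ∀ w, IsWord n w → ∀ i < n w.length, GeomSimilar (c w.length) (K (w ++ [i])) (K w)
  disjoint : ∀ w, IsWord n w → ∀ i < n w.length, ∀ j < n w.length, i ≠ j →
    Disjoint (interior (K (w ++ [i]))) (interior (K (w ++ [j])))

/-- The Moran class `𝓜(J, {n_k}, {c_k})`, i.e. the collection of all Moran sets with these
parameters. -/
def MoranClass {d : ℕ} (J : Set (EuclideanSpace ℝ (Fin d))) (n : ℕ → ℕ) (c : ℕ → ℝ) :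
    Set (Set (EuclideanSpace ℝ (Fin d))) :=
  {E | ∃ K : List ℕ → Set (EuclideanSpace ℝ (Fin d)), IsFamily J n c K ∧
    E = ⋂ k : ℕ, ⋃ w ∈ {w : List ℕ | IsWord n w ∧ w.length = k}, K w}

/-- The order of a scale `r`: the least `k` with `c_1 ⋯ c_k |J| < r`. For `0 < r ≤ |J|` it is the
`k ≥ 1` with `c_1 ⋯ c_k |J| < r ≤ c_1 ⋯ c_{k-1} |J|`; for `r > |J|` it is `0`. -/
def order {d : ℕ} (J : Set (EuclideanSpace ℝ (Fin d))) (c : ℕ → ℝ) (r : ℝ) : ℕ :=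
  sInf {k : ℕ | (∏ i ∈ Finset.range k, c i) * Metric.diam J < r}

/-- `Φ(r) = n_1 ⋯ n_k`, where `k` is the order of the scale `r`. -/
def Phi {d : ℕ} (J : Set (EuclideanSpace ℝ (Fin d))) (n : ℕ → ℕ) (c : ℕ → ℝ) (r : ℝ) : ℝ :=
  ∏ i ∈ Finset.range (order J c r), (n i : ℝ)

/-- `Φ(r, r') = Φ(r') / Φ(r)`. -/
def Phi₂ {d : ℕ} (J : Set (EuclideanSpace ℝ (Fin d))) (n : ℕ → ℕ) (c : ℕ → ℝ) (r r' : ℝ) : ℝ :=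
  Phi J n c r' / Phi J n c r

/-- Uniform disconnectedness of a (compact) subset `A` of a metric space. The distance between
`S` and `A \ S` is the extended infimum, so it is `∞` when one of them is empty. -/
def UniformlyDisconnected {X : Type*} [PseudoMetricSpace X] (A : Set X) : Prop :=
  ∃ C : ℝ, 1 < C ∧ ∃ rstar : ℝ, 0 < rstar ∧ ∀ x ∈ A, ∀ r : ℝ, 0 < r → r < rstar →
    ∃ S : Set X, S ⊆ A ∧ A ∩ Metric.closedBall x r ⊆ S ∧ S ⊆ Metric.closedBall x (C * r) ∧
      ENNReal.ofReal r < ⨅ y ∈ S, ⨅ z ∈ A \ S, edist y z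

/-- `X` can be bilipschitz embedded into `Y`. -/
def BilipschitzEmbeds (X Y : Type*) [MetricSpace X] [MetricSpace Y] : Prop :=
  ∃ f : X → Y, Function.Injective f ∧ ∃ L : ℝ, 1 ≤ L ∧ ∀ x₁ x₂ : X,
    dist x₁ x₂ / L ≤ dist (f x₁) (f x₂) ∧ dist (f x₁) (f x₂) ≤ L * dist x₁ x₂

/-- Quasi-Lipschitz equivalence of (compact) metric spaces: there is a bijection `f` with
`log d(f x₁, f x₂) / log d(x₁, x₂) → 1` uniformly as `d(x₁, x₂) → 0`, `x₁ ≠ x₂`. -/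
def QuasiLipschitzEquivalent (X Y : Type*) [MetricSpace X] [MetricSpace Y] : Prop :=
  ∃ f : X → Y, Function.Bijective f ∧ ∀ ε : ℝ, 0 < ε → ∃ δ : ℝ, 0 < δ ∧ ∀ x₁ x₂ : X,
    x₁ ≠ x₂ → dist x₁ x₂ < δ →
      |Real.log (dist (f x₁) (f x₂)) / Real.log (dist x₁ x₂) - 1| < ε

end Moran

end

/-! A Moran set carries a natural measure, the image of the uniform product measure on infinite
words, and every ball of radius `r` has mass comparable to `1 / Φ r` (`IsFamily.exists_isGauge`).
Indeed a basic element whose order is that of `r` has diameter below `r`, and comparing volumes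
shows that boundedly many of them meet a ball of radius `r`. Volume also gives `n_k c_k^p ≤ 1`, so
`log Φ` grows at least and at most linearly in `log (1 / r)`, up to constants, between any two small
scales (`IsFamily.exists_isRegular`). After that only a metric space with such a measure and such a
`Φ` matters: cardinalities of separated sets are controlled by `Φ`.

Statement 1: the limsup condition says that `log Φ` grows with slope `σ < 1`. A ball is then too
small to contain points in many consecutive annuli, so some annulus is empty and isolates a piece
(`uniformlyDisconnected_of_growth`).

Statement 2: in a uniformly disconnected space the `r`-chain components ("cells") have diameter
`O(r)`. A cell of `E` at scale `r` has at most about `Φ(r / N) / Φ(r)` subcells at scale `r / N`,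
while a ball of radius `r` in `F` has room for about `Ψ(r / N) / Ψ(r)` separated points. The
exponent `α < 1` makes the second number win for large `N`, and the tree of cells embeds into `F`
level by level (`bilipschitzEmbeds_of_gauge`).

Statement 3: both sets are coded by `∏ Fin (2 ^ j)` so that `log Φ` of a distance is `∑_{i<j} i log
2 + O(j)`, where `j` is the first place at which the codes differ (`IsSplitSystem.exists_coding`).
The main term is quadratic in `j`, so the error is negligible, and composing the codings gives the
equivalence when the gauges are asymptotic. Conversely, a quasi-Lipschitz bijection changes
separation only from `r` to `r ^ (1 + t)`, so packing counts compare `log Φ` with `log Ψ`. -/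

noncomputable section

namespace Moran

open MeasureTheory Measure
open scoped Pointwise

/-! ### Diameters and volumes of basic elements. -/

section Geometry

variable {p : ℕ}

/-- The Hausdorff measure of top dimension on `ℝ^p`. -/
abbrev topMeasure (p : ℕ) : Measure (EuclideanSpace ℝ (Fin p)) :=
  μH[(Module.finrank ℝ (EuclideanSpace ℝ (Fin p)) : ℝ)]

/-- Dividing by `r` leaves an isometry, which is affine by strict convexity and onto by equality of
dimensions. Hence similitudes scale volume by `r ^ p` and commute with interiors. -/
theorem exists_isometryEquiv_of_similitude {r : ℝ} (hr : 0 < r)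
    {S : EuclideanSpace ℝ (Fin p) → EuclideanSpace ℝ (Fin p)}
    (hS : ∀ x y, dist (S x) (S y) = r * dist x y) :
    ∃ T : EuclideanSpace ℝ (Fin p) ≃ᵃⁱ[ℝ] EuclideanSpace ℝ (Fin p), ∀ x, S x = r • T x := by
  have hT : Isometry (fun x => r⁻¹ • S x) := by
    refine Isometry.of_dist_eq fun x y => ?_
    rw [dist_smul₀, hS, Real.norm_of_nonneg (inv_nonneg.2 hr.le), inv_mul_cancel_left₀ hr.ne']
  refine ⟨hT.affineIsometryOfStrictConvexSpace.toAffineIsometryEquiv rfl, fun x => ?_⟩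
  change S x = r • (r⁻¹ • S x)
  rw [smul_inv_smul₀ hr.ne']

theorem GeomSimilar.exists_eq_smul {r : ℝ} (hr : 0 < r) {D₁ D₂ : Set (EuclideanSpace ℝ (Fin p))}
    (h : GeomSimilar r D₁ D₂) :
    ∃ T : EuclideanSpace ℝ (Fin p) ≃ᵃⁱ[ℝ] EuclideanSpace ℝ (Fin p), D₁ = r • (T '' D₂) := by
  obtain ⟨S, hS, rfl⟩ := h
  obtain ⟨T, hT⟩ := exists_isometryEquiv_of_similitude hr hS
  refine ⟨T, ?_⟩
  rw [← Set.image_smul, Set.image_image]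
  exact Set.image_congr fun x _ => hT x

theorem GeomSimilar.isCompact {r : ℝ} (hr : 0 < r) {D₁ D₂ : Set (EuclideanSpace ℝ (Fin p))}
    (h : GeomSimilar r D₁ D₂) (h₂ : IsCompact D₂) : IsCompact D₁ := by
  obtain ⟨T, rfl⟩ := h.exists_eq_smul hr
  exact (h₂.image T.continuous).smul r

theorem GeomSimilar.diam_eq {r : ℝ} (hr : 0 < r) {D₁ D₂ : Set (EuclideanSpace ℝ (Fin p))}
    (h : GeomSimilar r D₁ D₂) : Metric.diam D₁ = r * Metric.diam D₂ := by
  obtain ⟨T, rfl⟩ := h.exists_eq_smul hr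
  rw [diam_smul₀, T.isometry.diam_image, Real.norm_of_nonneg hr.le]

theorem GeomSimilar.measure_interior {r : ℝ} (hr : 0 < r)
    {D₁ D₂ : Set (EuclideanSpace ℝ (Fin p))} (h : GeomSimilar r D₁ D₂) :
    (topMeasure p).real (interior D₁) = r ^ p * (topMeasure p).real (interior D₂) := by
  obtain ⟨T, rfl⟩ := h.exists_eq_smul hr
  rw [interior_smul₀ hr.ne', ← T.coe_toHomeomorph, ← Homeomorph.image_interior, T.coe_toHomeomorph]
  rw [measureReal_def, measureReal_def, addHaar_smul, ENNReal.toReal_mul,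
    T.isometry.hausdorffMeasure_image (Or.inl (by positivity))]
  rw [ENNReal.toReal_ofReal (abs_nonneg _), abs_of_nonneg (by positivity)]
  simp [topMeasure]

theorem isWord_append_singleton {n : ℕ → ℕ} {w : List ℕ} {i : ℕ} :
    IsWord n (w ++ [i]) ↔ IsWord n w ∧ i < n w.length := by
  constructor
  · intro h
    refine ⟨fun t ht => ?_, ?_⟩
    · have := h t (by simp; omega)
      rwa [List.getElem_append_left ht] at this
    · have := h w.length (by simp)
      simpa using this
  · rintro ⟨h, hi⟩ t ht
    rcases Nat.lt_or_ge t w.length with h' | h'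
    · rw [List.getElem_append_left h']
      exact h t h'
    · have : t = w.length := by simp at ht; omega
      subst this
      simpa using hi

variable {J : Set (EuclideanSpace ℝ (Fin p))} {n : ℕ → ℕ} {c : ℕ → ℝ}
  {K : List ℕ → Set (EuclideanSpace ℝ (Fin p))}

theorem IsFamily.isCompact (hA : IsData J n c) (hK : IsFamily J n c K) (w : List ℕ)
    (hw : IsWord n w) : IsCompact (K w) := by
  induction w using List.reverseRecOn with
  | nil => rw [hK.root]; exact hA.isCompact
  | append_singleton w i ih =>
    obtain ⟨h₁, h₂⟩ := isWord_append_singleton.1 hw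
    exact (hK.similar w h₁ i h₂).isCompact (hA.pos _) (ih h₁)

theorem IsFamily.diam_eq (hA : IsData J n c) (hK : IsFamily J n c K) (w : List ℕ)
    (hw : IsWord n w) :
    Metric.diam (K w) = (∏ i ∈ Finset.range w.length, c i) * Metric.diam J := by
  induction w using List.reverseRecOn with
  | nil => simp [hK.root]
  | append_singleton w i ih =>
    obtain ⟨h₁, h₂⟩ := isWord_append_singleton.1 hw
    rw [(hK.similar w h₁ i h₂).diam_eq (hA.pos _), ih h₁, List.length_append,
      List.length_singleton, Finset.prod_range_succ]
    ring

theorem IsFamily.measure_interior (hA : IsData J n c) (hK : IsFamily J n c K) (w : List ℕ)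
    (hw : IsWord n w) :
    (topMeasure p).real (interior (K w)) =
      (∏ i ∈ Finset.range w.length, c i) ^ p * (topMeasure p).real (interior J) := by
  induction w using List.reverseRecOn with
  | nil => simp [hK.root]
  | append_singleton w i ih =>
    obtain ⟨h₁, h₂⟩ := isWord_append_singleton.1 hw
    rw [(hK.similar w h₁ i h₂).measure_interior (hA.pos _), ih h₁, List.length_append,
      List.length_singleton, Finset.prod_range_succ, mul_pow]
    ring

theorem IsFamily.disjoint_interior (hK : IsFamily J n c K) (w w' : List ℕ)
    (hw : IsWord n w) (hw' : IsWord n w') (hl : w.length = w'.length) (hne : w ≠ w') :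
    Disjoint (interior (K w)) (interior (K w')) := by
  induction w using List.reverseRecOn generalizing w' with
  | nil => exact absurd (List.length_eq_zero_iff.1 hl.symm).symm hne
  | append_singleton w i ih =>
    obtain ⟨h₁, h₂⟩ := isWord_append_singleton.1 hw
    rcases List.eq_nil_or_concat w' with rfl | ⟨v, j, rfl⟩
    · simp at hl
    · rw [List.concat_eq_append] at *
      obtain ⟨h₃, h₄⟩ := isWord_append_singleton.1 hw'
      have hl' : w.length = v.length := by simpa using hl
      by_cases hwv : w = v
      · subst hwv
        exact hK.disjoint w h₁ i h₂ j h₄ (by rintro rfl; exact hne rfl)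
      · exact (ih v h₁ h₃ hl' hwv).mono (interior_mono (hK.subset w h₁ i h₂))
          (interior_mono (hK.subset v h₃ j h₄))

theorem IsData.measure_interior_pos (hA : IsData J n c) :
    0 < (topMeasure p).real (interior J) := by
  rw [measureReal_def, ENNReal.toReal_pos_iff]
  exact ⟨isOpen_interior.measure_pos _ hA.interior_nonempty,
    (measure_mono interior_subset).trans_lt hA.isCompact.measure_lt_top⟩

theorem exists_isWord {n : ℕ → ℕ} (hn : ∀ k, 2 ≤ n k) (k : ℕ) :
    ∃ w, IsWord n w ∧ w.length = k := by
  refine ⟨List.replicate k 0, fun t ht => ?_, by simp⟩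
  have := hn t
  simp
  omega

/-- The interiors of the `n k` children are disjoint, lie in the interior of the parent, and each
has `c k ^ p` times its volume. This inequality ties `n` to `c` and excludes `p = 0`. -/
theorem IsFamily.mul_pow_le_one (hA : IsData J n c) (hK : IsFamily J n c K) (k : ℕ) :
    (n k : ℝ) * c k ^ p ≤ 1 := by
  obtain ⟨w, hw, rfl⟩ := exists_isWord hA.two_le k
  have hV := hA.measure_interior_pos
  set P := ∏ i ∈ Finset.range w.length, c i with hP
  have hPpos : 0 < P := Finset.prod_pos fun i _ => hA.pos i
  have hword : ∀ i ∈ Finset.range (n w.length), IsWord n (w ++ [i]) := fun i hi =>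
    isWord_append_singleton.2 ⟨hw, Finset.mem_range.1 hi⟩
  have hfin : topMeasure p (interior (K w)) ≠ ⊤ :=
    ((measure_mono interior_subset).trans_lt (hK.isCompact hA w hw).measure_lt_top).ne
  have h₁ : (topMeasure p).real (⋃ i ∈ Finset.range (n w.length), interior (K (w ++ [i]))) =
      ∑ i ∈ Finset.range (n w.length), (topMeasure p).real (interior (K (w ++ [i]))) := by
    refine measureReal_biUnion_finset ?_ (fun i _ => isOpen_interior.measurableSet) ?_
    · intro i hi j hj hij
      exact hK.disjoint w hw i (by simpa using hi) j (by simpa using hj) hij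
    · intro i hi
      exact ((measure_mono interior_subset).trans_lt
        (hK.isCompact hA _ (hword i hi)).measure_lt_top).ne
  have h₂ : (topMeasure p).real (⋃ i ∈ Finset.range (n w.length), interior (K (w ++ [i]))) ≤
      (topMeasure p).real (interior (K w)) := by
    refine measureReal_mono (Set.iUnion₂_subset fun i hi => ?_) hfin
    exact interior_mono (hK.subset w hw i (Finset.mem_range.1 hi))
  rw [h₁, Finset.sum_congr rfl fun i hi => hK.measure_interior hA _ (hword i hi),
    hK.measure_interior hA w hw] at h₂
  simp only [List.length_append, List.length_singleton, Finset.prod_range_succ, Finset.sum_const,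
    Finset.card_range, nsmul_eq_mul, ← hP, mul_pow] at h₂
  have h₃ : (n w.length : ℝ) * c w.length ^ p * (P ^ p * (topMeasure p).real (interior J)) ≤
      1 * (P ^ p * (topMeasure p).real (interior J)) := by linarith
  exact le_of_mul_le_mul_right h₃ (by positivity)

end Geometry

/-! ### Regularity of `Φ` as a function of the scale. -/

/-- A function of the scale that is antitone and grows at least like `r ^ (-s)` and at most
polynomially in `1 / r`, in the multiplicative sense. -/
structure IsRegular (Φ : ℝ → ℝ) (s K R : ℝ) : Prop where
  s_pos : 0 < s
  K_pos : 0 < K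
  R_pos : 0 < R
  one_le : ∀ r, 1 ≤ Φ r
  anti : ∀ r' r, 0 < r' → r' ≤ r → Φ r ≤ Φ r'
  upper : ∀ r' r, 0 < r' → r' ≤ r →
    Real.log (Φ r') ≤ Real.log (Φ r) + K * (1 + Real.log (r / r'))
  lower : ∀ r' r, 0 < r' → r' ≤ r → r ≤ R →
    Real.log (Φ r) + s * Real.log (r / r') - K ≤ Real.log (Φ r')

section Regularity

variable {p : ℕ} {J : Set (EuclideanSpace ℝ (Fin p))} {n : ℕ → ℕ} {c : ℕ → ℝ}
  {K : List ℕ → Set (EuclideanSpace ℝ (Fin p))}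

theorem IsFamily.dim_pos (hA : IsData J n c) (hK : IsFamily J n c K) : 0 < p := by
  rcases Nat.eq_zero_or_pos p with h | h
  · have h₁ := hK.mul_pow_le_one hA 0
    have h₂ : (2 : ℝ) ≤ n 0 := by exact_mod_cast hA.two_le 0
    rw [h, pow_zero, mul_one] at h₁
    linarith
  · exact h

theorem IsFamily.diam_pos (hA : IsData J n c) (hK : IsFamily J n c K) : 0 < Metric.diam J := by
  have hp := hK.dim_pos hA
  have : Nonempty (Fin p) := ⟨⟨0, hp⟩⟩
  obtain ⟨x, hx⟩ := hA.interior_nonempty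
  have hinf : J.Infinite := infinite_of_mem_nhds x (mem_interior_iff_mem_nhds.1 hx)
  exact Metric.diam_pos hinf.nontrivial hA.isCompact.isBounded

theorem IsData.exists_log_le (hA : IsData J n c) : ∃ b, 0 < b ∧ ∀ k, -Real.log (c k) ≤ b := by
  have hi := hA.iInf_pos
  have hle : ∀ k, ⨅ k, c k ≤ c k := fun k =>
    ciInf_le ⟨0, by rintro _ ⟨k, rfl⟩; exact (hA.pos k).le⟩ k
  refine ⟨-Real.log (⨅ k, c k), ?_, fun k => neg_le_neg (Real.log_le_log hi (hle k))⟩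
  have := Real.log_neg hi ((hle 0).trans_lt (hA.lt_one 0))
  linarith

theorem IsFamily.log_le (hA : IsData J n c) (hK : IsFamily J n c K) (k : ℕ) :
    Real.log (n k) ≤ p * -Real.log (c k) := by
  have h := hK.mul_pow_le_one hA k
  have hn : (0 : ℝ) < n k := by
    have := hA.two_le k
    exact_mod_cast (by omega : 0 < n k)
  have hc := hA.pos k
  have := Real.log_nonpos (by positivity) h
  rw [Real.log_mul hn.ne' (by positivity), Real.log_pow] at this
  linarith

theorem IsData.log_two_le (hA : IsData J n c) (k : ℕ) : Real.log 2 ≤ Real.log (n k) :=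
  Real.log_le_log two_pos (by exact_mod_cast hA.two_le k)

/-- The bound `b` comes from the positive infimum of the ratios. Inserting `2 ≤ n k` into `n k * c k
^ p ≤ 1` keeps `c k` away from `1`, and the same inequality with `b` bounds `n k`. -/
theorem IsFamily.exists_bounds (hA : IsData J n c) (hK : IsFamily J n c K) :
    ∃ a b M : ℝ, 0 < a ∧ 0 < b ∧ 0 < M ∧
      ∀ k, a ≤ -Real.log (c k) ∧ -Real.log (c k) ≤ b ∧ Real.log (n k) ≤ M := by
  obtain ⟨b, hb, hcb⟩ := hA.exists_log_le
  have hp : (0 : ℝ) < p := by exact_mod_cast hK.dim_pos hA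
  refine ⟨Real.log 2 / p, b, p * b, by positivity, hb, by positivity, fun k => ⟨?_, hcb k, ?_⟩⟩
  · rw [div_le_iff₀ hp]
    linarith [hK.log_le hA k, hA.log_two_le k]
  · exact (hK.log_le hA k).trans (mul_le_mul_of_nonneg_left (hcb k) hp.le)

theorem log_prod_range (hA : IsData J n c) (k : ℕ) :
    Real.log (∏ i ∈ Finset.range k, c i) = -∑ i ∈ Finset.range k, -Real.log (c i) := by
  rw [Real.log_prod fun i _ => (hA.pos i).ne', Finset.sum_neg_distrib, neg_neg]

theorem log_Phi (hA : IsData J n c) (r : ℝ) :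
    Real.log (Phi J n c r) = ∑ i ∈ Finset.range (order J c r), Real.log (n i) := by
  refine Real.log_prod fun i _ => ?_
  have := hA.two_le i
  exact_mod_cast (by omega : n i ≠ 0)

theorem one_le_Phi (hA : IsData J n c) (r : ℝ) : 1 ≤ Phi J n c r := by
  rw [Phi, ← Nat.cast_prod]
  exact_mod_cast Nat.one_le_iff_ne_zero.2 (Finset.prod_ne_zero_iff.2 fun i _ => by
    have := hA.two_le i
    omega)

theorem IsFamily.order_spec (hA : IsData J n c) (hK : IsFamily J n c K) {r : ℝ} (hr : 0 < r) :
    (∏ i ∈ Finset.range (order J c r), c i) * Metric.diam J < r := by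
  have hD := hK.diam_pos hA
  obtain ⟨a, b, M, ha, -, -, hab⟩ := hK.exists_bounds hA
  refine Nat.sInf_mem (s := {k : ℕ | (∏ i ∈ Finset.range k, c i) * Metric.diam J < r}) ?_
  obtain ⟨k, hk⟩ := exists_nat_gt ((Real.log (Metric.diam J) - Real.log r) / a)
  rw [div_lt_iff₀ ha] at hk
  refine ⟨k, ?_⟩
  have hP : 0 < ∏ i ∈ Finset.range k, c i := Finset.prod_pos fun i _ => hA.pos i
  rw [Set.mem_ofPred_eq, ← Real.log_lt_log_iff (by positivity) hr,
    Real.log_mul hP.ne' hD.ne', log_prod_range hA]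
  have : ∑ i ∈ Finset.range k, a ≤ ∑ i ∈ Finset.range k, -Real.log (c i) :=
    Finset.sum_le_sum fun i _ => (hab i).1
  rw [Finset.sum_const, Finset.card_range, nsmul_eq_mul] at this
  linarith

theorem le_of_lt_order {r : ℝ} {j : ℕ} (hj : j < order J c r) :
    r ≤ (∏ i ∈ Finset.range j, c i) * Metric.diam J :=
  not_lt.1 (Nat.notMem_of_lt_sInf hj)

theorem IsFamily.log_sub_lt (hA : IsData J n c) (hK : IsFamily J n c K) {r : ℝ} (hr : 0 < r) :
    Real.log (Metric.diam J) - ∑ i ∈ Finset.range (order J c r), -Real.log (c i) < Real.log r := by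
  have hP : 0 < ∏ i ∈ Finset.range (order J c r), c i := Finset.prod_pos fun i _ => hA.pos i
  have hD := hK.diam_pos hA
  have h := Real.log_lt_log (by positivity) (hK.order_spec hA hr)
  rw [Real.log_mul hP.ne' hD.ne', log_prod_range hA] at h
  linarith

theorem IsFamily.log_le_sub (hA : IsData J n c) (hK : IsFamily J n c K) {r : ℝ} (hr : 0 < r)
    {j : ℕ} (hj : j < order J c r) :
    Real.log r ≤ Real.log (Metric.diam J) - ∑ i ∈ Finset.range j, -Real.log (c i) := by
  have hP : 0 < ∏ i ∈ Finset.range j, c i := Finset.prod_pos fun i _ => hA.pos i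
  have hD := hK.diam_pos hA
  have h := Real.log_le_log hr (le_of_lt_order hj)
  rw [Real.log_mul hP.ne' hD.ne', log_prod_range hA] at h
  linarith

theorem IsFamily.order_anti (hA : IsData J n c) (hK : IsFamily J n c K) {r' r : ℝ} (hr' : 0 < r')
    (h : r' ≤ r) : order J c r ≤ order J c r' :=
  Nat.sInf_le ((hK.order_spec hA hr').trans_le h)

/-- The scale `r'` is known to lie below the size of elements one level before its order, so the sum
must stop one term early. -/
theorem IsFamily.sum_le_log_div (hA : IsData J n c) (hK : IsFamily J n c K) {r' r : ℝ}
    (hr' : 0 < r') (h : r' ≤ r) {l : ℕ} (hl : order J c r' = l + 1) (hlt : order J c r ≤ l) :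
    ∑ i ∈ Finset.Ico (order J c r) l, -Real.log (c i) ≤ Real.log (r / r') := by
  have hr := hr'.trans_le h
  rw [Finset.sum_Ico_eq_sub _ hlt, Real.log_div hr.ne' hr'.ne']
  linarith [hK.log_sub_lt hA hr, hK.log_le_sub hA hr' (j := l) (by omega)]

theorem log_Phi_sub (hA : IsData J n c) {r' r : ℝ} (h : order J c r ≤ order J c r') :
    Real.log (Phi J n c r') = Real.log (Phi J n c r) +
      ∑ i ∈ Finset.Ico (order J c r) (order J c r'), Real.log (n i) := by
  rw [log_Phi hA, log_Phi hA, Finset.sum_Ico_eq_sub _ h]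
  ring

theorem IsFamily.exists_isRegular (hA : IsData J n c) (hK : IsFamily J n c K) :
    ∃ s L : ℝ, IsRegular (Phi J n c) s L (Metric.diam J) := by
  obtain ⟨a, b, M, ha, hb, hM, hab⟩ := hK.exists_bounds hA
  have h2 : 0 < Real.log 2 := Real.log_pos one_lt_two
  -- One level adds at least `log 2` to `log Φ` and uses at most `b` of `log (1 / r)`, whence `s`.
  -- In the constant, `M / a` is the largest slope; `M` and `log 2` pay for the level lost at the
  -- ends in the upper and lower estimates.
  refine ⟨Real.log 2 / b, M + M / a + Real.log 2, by positivity, by positivity, hK.diam_pos hA,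
    one_le_Phi hA, ?_, ?_, ?_⟩
  · intro r' r hr' h
    have ho := hK.order_anti hA hr' h
    rw [← Real.log_le_log_iff (by linarith [one_le_Phi hA r]) (by linarith [one_le_Phi hA r']),
      log_Phi_sub hA ho]
    exact le_add_of_nonneg_right (Finset.sum_nonneg fun i _ => h2.le.trans (hA.log_two_le i))
  · intro r' r hr' h
    have ho := hK.order_anti hA hr' h
    have hlog : 0 ≤ Real.log (r / r') := Real.log_nonneg ((one_le_div hr').2 h)
    rw [log_Phi_sub hA ho]
    gcongr
    rcases ho.eq_or_lt with he | hlt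
    · rw [he, Finset.Ico_self, Finset.sum_empty]
      positivity
    obtain ⟨l, hl⟩ : ∃ l, order J c r' = l + 1 := ⟨order J c r' - 1, by omega⟩
    have h₁ := hK.sum_le_log_div hA hr' h hl (by omega)
    have h₂ : ∑ i ∈ Finset.Ico (order J c r) (order J c r'), Real.log (n i) ≤
        ∑ i ∈ Finset.Ico (order J c r) (order J c r'), M :=
      Finset.sum_le_sum fun i _ => (hab i).2.2
    have h₃ : ∑ i ∈ Finset.Ico (order J c r) l, a ≤
        ∑ i ∈ Finset.Ico (order J c r) l, -Real.log (c i) :=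
      Finset.sum_le_sum fun i _ => (hab i).1
    rw [Finset.sum_const, Nat.card_Ico, nsmul_eq_mul, Nat.cast_sub (by omega)] at h₂ h₃
    have hl' : (order J c r' : ℝ) = l + 1 := by exact_mod_cast hl
    have h₄ : (l : ℝ) - order J c r ≤ Real.log (r / r') / a := by
      rw [le_div_iff₀ ha]; linarith
    have h₅ : M * ((l : ℝ) - order J c r) ≤ M * (Real.log (r / r') / a) :=
      mul_le_mul_of_nonneg_left h₄ hM.le
    have h₆ : M * (Real.log (r / r') / a) = M / a * Real.log (r / r') := by ring
    have h₇ : 0 ≤ M / a := by positivity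
    have h₈ : 0 ≤ (M + Real.log 2) * Real.log (r / r') := by positivity
    rw [hl'] at h₂
    linarith
  · intro r' r hr' h hrD
    have hr := hr'.trans_le h
    have ho := hK.order_anti hA hr' h
    -- The restriction `r ≤ |J|` enters here: it provides a level before the order of `r`, whose
    -- size bounds `r` from above.
    have hk : 0 < order J c r := by
      by_contra hk
      have h0 : order J c r = 0 := by omega
      have := hK.order_spec hA hr
      rw [h0] at this
      simp at this
      linarith
    rw [log_Phi_sub hA ho]
    have h₁ := hK.log_sub_lt hA hr'
    have h₂ := hK.log_le_sub hA hr (j := order J c r - 1) (by omega)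
    have h₃ : ∑ i ∈ Finset.Ico (order J c r) (order J c r'), Real.log 2 ≤
        ∑ i ∈ Finset.Ico (order J c r) (order J c r'), Real.log (n i) :=
      Finset.sum_le_sum fun i _ => hA.log_two_le i
    have h₄ : ∑ i ∈ Finset.Ico (order J c r - 1) (order J c r'), -Real.log (c i) ≤
        ∑ i ∈ Finset.Ico (order J c r - 1) (order J c r'), b :=
      Finset.sum_le_sum fun i _ => (hab i).2.1
    have h₅ : Real.log (r / r') ≤
        ∑ i ∈ Finset.Ico (order J c r - 1) (order J c r'), -Real.log (c i) := by
      rw [Finset.sum_Ico_eq_sub _ (by omega), Real.log_div hr.ne' hr'.ne']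
      linarith
    rw [Finset.sum_const, Nat.card_Ico, nsmul_eq_mul, Nat.cast_sub (by omega)] at h₃ h₄
    rw [Nat.cast_sub (by omega), Nat.cast_one] at h₄
    have h₆ : Real.log 2 / b * Real.log (r / r') ≤
        Real.log 2 / b * (((order J c r' : ℝ) - (order J c r - 1)) * b) :=
      mul_le_mul_of_nonneg_left (h₅.trans h₄) (by positivity)
    have h₇ : Real.log 2 / b * (((order J c r' : ℝ) - (order J c r - 1)) * b) =
        Real.log 2 * ((order J c r' : ℝ) - order J c r) + Real.log 2 := by
      field_simp
      ring
    have h₈ : 0 ≤ M / a := by positivity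
    linarith

/-- Full blocks of length `k₀` are peeled off from the left; the incomplete last block costs at most
`k₀ * M`. -/
theorem sum_le_of_block_le {u v : ℕ → ℝ} {σ M : ℝ} {k₀ N : ℕ} (hk₀ : 1 ≤ k₀) (hσ : 0 ≤ σ)
    (hM : 0 ≤ M) (hv : ∀ k, 0 ≤ v k) (hu : ∀ k, u k ≤ M)
    (h : ∀ k ≥ N, ∑ i ∈ Finset.range k₀, u (k + i) ≤ σ * ∑ i ∈ Finset.range k₀, v (k + i))
    (j : ℕ) : ∀ k ≥ N, ∑ i ∈ Finset.range j, u (k + i) ≤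
      σ * ∑ i ∈ Finset.range j, v (k + i) + k₀ * M := by
  induction j using Nat.strong_induction_on with
  | _ j ih =>
    intro k hk
    rcases Nat.lt_or_ge j k₀ with hj | hj
    · have h₁ : ∑ i ∈ Finset.range j, u (k + i) ≤ ∑ i ∈ Finset.range j, M :=
        Finset.sum_le_sum fun i _ => hu _
      have h₂ : 0 ≤ ∑ i ∈ Finset.range j, v (k + i) := Finset.sum_nonneg fun i _ => hv _
      rw [Finset.sum_const, Finset.card_range, nsmul_eq_mul] at h₁
      have h₃ : (j : ℝ) * M ≤ k₀ * M := by gcongr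
      have h₄ := mul_nonneg hσ h₂
      linarith
    · obtain ⟨e, rfl⟩ := Nat.exists_eq_add_of_le hj
      rw [Finset.sum_range_add, Finset.sum_range_add]
      have h₁ := ih e (by omega) (k + k₀) (by omega)
      simp only [add_assoc] at h₁
      linarith [h k hk]

theorem IsFamily.exists_growth (hA : IsData J n c) (hK : IsFamily J n c K) {k₀ : ℕ} (hk₀ : 1 ≤ k₀)
    (h : limsup (fun k : ℕ =>
        ((Real.log (∏ i ∈ Finset.range k₀, (n (k + i) : ℝ)) /
          -Real.log (∏ i ∈ Finset.range k₀, c (k + i)) : ℝ) : EReal)) atTop < 1) :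
    ∃ σ L R : ℝ, 0 ≤ σ ∧ σ < 1 ∧ 0 < R ∧ ∀ r' r, 0 < r' → r' ≤ r → r ≤ R →
      Real.log (Phi J n c r') ≤ Real.log (Phi J n c r) + σ * Real.log (r / r') + L := by
  obtain ⟨a, b, M, ha, hb, hM, hab⟩ := hK.exists_bounds hA
  obtain ⟨σ₀, hσ₁, hσ₂⟩ := EReal.lt_iff_exists_real_btwn.1 h
  have hev := eventually_lt_of_limsup_lt hσ₁
  obtain ⟨N, hN⟩ := eventually_atTop.1 hev
  have hσ₀ : σ₀ < 1 := by exact_mod_cast hσ₂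
  set σ := max σ₀ 0 with hσ
  have hσ0 : 0 ≤ σ := le_max_right _ _
  have hblock : ∀ k ≥ N, ∑ i ∈ Finset.range k₀, Real.log (n (k + i)) ≤
      σ * ∑ i ∈ Finset.range k₀, -Real.log (c (k + i)) := by
    intro k hk
    have h₁ := hN k hk
    rw [EReal.coe_lt_coe_iff, Real.log_prod, Real.log_prod fun i _ => (hA.pos _).ne',
      ← Finset.sum_neg_distrib] at h₁
    · have hpos : 0 < ∑ i ∈ Finset.range k₀, -Real.log (c (k + i)) :=
        Finset.sum_pos (fun i _ => ha.trans_le (hab _).1) ⟨0, Finset.mem_range.2 hk₀⟩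
      rw [div_lt_iff₀ hpos] at h₁
      exact h₁.le.trans (mul_le_mul_of_nonneg_right (le_max_left _ _) hpos.le)
    · intro i _
      have := hA.two_le (k + i)
      exact_mod_cast (by omega : n (k + i) ≠ 0)
  have hD := hK.diam_pos hA
  have hP : 0 < ∏ i ∈ Finset.range N, c i := Finset.prod_pos fun i _ => hA.pos i
  -- At scales up to this radius the order is at least `N`, where the block estimate is available.
  -- The extra `M` is the last level, not covered by `sum_le_log_div`.
  refine ⟨σ, k₀ * M + M, (∏ i ∈ Finset.range N, c i) * Metric.diam J, hσ0,
    max_lt hσ₀ one_pos, by positivity, ?_⟩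
  intro r' r hr' hrr hrR
  have hr := hr'.trans_le hrr
  have ho := hK.order_anti hA hr' hrr
  have hlog : 0 ≤ Real.log (r / r') := Real.log_nonneg ((one_le_div hr').2 hrr)
  have hNk : N ≤ order J c r := by
    by_contra hlt
    have h₁ := hK.order_spec hA hr
    have h₂ : ∏ i ∈ Finset.range N, c i ≤ ∏ i ∈ Finset.range (order J c r), c i :=
      antitone_nat_of_succ_le (f := fun N => ∏ i ∈ Finset.range N, c i) (fun N => by
        rw [Finset.prod_range_succ]
        exact mul_le_of_le_one_right (Finset.prod_nonneg fun i _ => (hA.pos i).le)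
          (hA.lt_one N).le) (not_le.1 hlt).le
    have h₃ := mul_le_mul_of_nonneg_right h₂ hD.le
    linarith
  rw [log_Phi_sub hA ho, add_assoc]
  gcongr
  rcases ho.eq_or_lt with he | hlt
  · rw [he, Finset.Ico_self, Finset.sum_empty]
    positivity
  obtain ⟨l, hl⟩ : ∃ l, order J c r' = l + 1 := ⟨order J c r' - 1, by omega⟩
  have h₁ := hK.sum_le_log_div hA hr' hrr hl (by omega)
  rw [hl, Finset.sum_Ico_succ_top (by omega)]
  have h₂ := sum_le_of_block_le hk₀ hσ0 hM.le (fun k => ha.le.trans (hab k).1)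
    (fun k => (hab k).2.2) hblock (l - order J c r) (order J c r) hNk
  rw [Finset.sum_Ico_eq_sum_range] at h₁ ⊢
  have h₃ := mul_le_mul_of_nonneg_left h₁ hσ0
  linarith [(hab l).2.2]

end Regularity

/-! ### The natural measure of a Moran set. -/

/-- The measure of a ball of radius `r` is comparable to `1 / Φ r`. -/
structure IsGauge {X : Type*} [MetricSpace X] [MeasurableSpace X] (μ : Measure X) (Φ : ℝ → ℝ)
    (C : ℝ) : Prop where
  lower : ∀ x r, 0 < r → 1 ≤ Φ r * μ.real (Metric.closedBall x r)
  upper : ∀ x r, 0 < r → Φ r * μ.real (Metric.closedBall x r) ≤ C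

/-- The word with letters `τ 0, …, τ (k - 1)`. -/
def toWord {n : ℕ → ℕ} {k : ℕ} (τ : ∀ i : Fin k, Fin (n i)) : List ℕ :=
  List.ofFn fun i => (τ i : ℕ)

/-- The first `k` letters of an infinite word. -/
def firstLetters {n : ℕ → ℕ} (k : ℕ) (ω : ∀ i, Fin (n i)) : ∀ i : Fin k, Fin (n i) :=
  fun i => ω i

section Words

variable {n : ℕ → ℕ}

theorem length_toWord {k : ℕ} (τ : ∀ i : Fin k, Fin (n i)) : (toWord τ).length = k := by
  simp [toWord]

theorem isWord_toWord {k : ℕ} (τ : ∀ i : Fin k, Fin (n i)) : IsWord n (toWord τ) := by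
  intro t ht
  have ht' : t < k := by simpa [toWord] using ht
  have : (toWord τ)[t] = (τ ⟨t, ht'⟩ : ℕ) := by simp [toWord]
  rw [this]
  exact (τ ⟨t, ht'⟩).2

theorem exists_toWord_eq {w : List ℕ} (hw : IsWord n w) :
    ∃ τ : ∀ i : Fin w.length, Fin (n i), toWord τ = w :=
  ⟨fun i => ⟨w[i], hw i i.2⟩, by simp [toWord]⟩

theorem toWord_injective {k : ℕ} :
    Function.Injective (toWord : (∀ i : Fin k, Fin (n i)) → List ℕ) := by
  intro τ τ' h
  have := List.ofFn_injective h
  funext i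
  exact Fin.ext (congrFun this i)

theorem toWord_firstLetters_succ (k : ℕ) (ω : ∀ i, Fin (n i)) :
    toWord (firstLetters (k + 1) ω) = toWord (firstLetters k ω) ++ [(ω k : ℕ)] := by
  unfold toWord firstLetters
  rw [List.ofFn_succ_last]
  rfl

theorem finite_setOf_isWord (k : ℕ) : {w : List ℕ | IsWord n w ∧ w.length = k}.Finite := by
  refine (Set.finite_range (toWord : (∀ i : Fin k, Fin (n i)) → List ℕ)).subset ?_
  rintro w ⟨hw, rfl⟩
  exact exists_toWord_eq hw

/-- The uniform product measure on infinite words. -/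
def wordMeasure (n : ℕ → ℕ) : Measure (∀ i, Fin (n i)) :=
  Measure.infinitePi fun _ => ProbabilityTheory.uniformOn Set.univ

theorem isProbabilityMeasure_uniformOn (hn : ∀ k, 2 ≤ n k) (k : ℕ) :
    IsProbabilityMeasure (ProbabilityTheory.uniformOn (Set.univ : Set (Fin (n k)))) :=
  have : Nonempty (Fin (n k)) := ⟨⟨0, lt_of_lt_of_le two_pos (hn k)⟩⟩
  ProbabilityTheory.isProbabilityMeasure_uniformOn Set.finite_univ Set.univ_nonempty

theorem isProbabilityMeasure_wordMeasure (hn : ∀ k, 2 ≤ n k) :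
    IsProbabilityMeasure (wordMeasure n) := by
  have := isProbabilityMeasure_uniformOn hn
  unfold wordMeasure
  infer_instance

theorem setOf_firstLetters_eq {k : ℕ} (τ : ∀ i : Fin k, Fin (n i)) :
    {ω | firstLetters k ω = τ} =
      ((Finset.range k : Finset ℕ) : Set ℕ).pi
        fun i => if h : i < k then ({τ ⟨i, h⟩} : Set (Fin (n i))) else Set.univ := by
  ext ω
  simp only [Set.mem_ofPred_eq, Set.mem_pi, Finset.coe_range, Set.mem_Iio]
  constructor
  · rintro rfl i hi
    simp [hi, firstLetters]
  · intro h
    funext i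
    have := h i i.2
    exact (by simpa [i.2] using this : ω i = τ i)

theorem wordMeasure_firstLetters (hn : ∀ k, 2 ≤ n k) {k : ℕ} (τ : ∀ i : Fin k, Fin (n i)) :
    (wordMeasure n).real {ω | firstLetters k ω = τ} = (∏ i ∈ Finset.range k, (n i : ℝ))⁻¹ := by
  have := isProbabilityMeasure_uniformOn hn
  rw [setOf_firstLetters_eq, measureReal_def, wordMeasure,
    Measure.infinitePi_pi _ fun i _ => MeasurableSet.of_discrete, ENNReal.toReal_prod,
    ← Finset.prod_inv_distrib]
  refine Finset.prod_congr rfl fun i hi => ?_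
  rw [dif_pos (Finset.mem_range.1 hi), ProbabilityTheory.uniformOn_univ]
  simp

theorem isOpen_setOf_firstLetters_eq {k : ℕ} (τ : ∀ i : Fin k, Fin (n i)) :
    IsOpen {ω | firstLetters k ω = τ} := by
  rw [setOf_firstLetters_eq]
  exact isOpen_set_pi (Finset.finite_toSet _) fun i _ => isOpen_discrete _

end Words

section Measure

variable {p : ℕ} {J : Set (EuclideanSpace ℝ (Fin p))} {n : ℕ → ℕ} {c : ℕ → ℝ}
  {K : List ℕ → Set (EuclideanSpace ℝ (Fin p))}

/-- The limit set of a family of basic elements. -/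
def limitSet (n : ℕ → ℕ) (K : List ℕ → Set (EuclideanSpace ℝ (Fin p))) :
    Set (EuclideanSpace ℝ (Fin p)) :=
  ⋂ k : ℕ, ⋃ w ∈ {w : List ℕ | IsWord n w ∧ w.length = k}, K w

theorem IsFamily.isCompact_limitSet (hA : IsData J n c) (hK : IsFamily J n c K) :
    IsCompact (limitSet n K) := by
  refine hA.isCompact.of_isClosed_subset (isClosed_iInter fun k => ?_) ?_
  · exact (finite_setOf_isWord k).isClosed_biUnion fun w hw => (hK.isCompact hA w hw.1).isClosed
  · intro x hx
    obtain ⟨w, hw, hxw⟩ := Set.mem_iUnion₂.1 (Set.mem_iInter.1 hx 0)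
    rw [List.length_eq_zero_iff.1 hw.2, hK.root] at hxw
    exact hxw

theorem IsFamily.nonempty (hA : IsData J n c) (hK : IsFamily J n c K) {w : List ℕ}
    (hw : IsWord n w) : (K w).Nonempty := by
  by_contra h
  rw [Set.not_nonempty_iff_eq_empty] at h
  have h₁ := hK.measure_interior hA w hw
  have h₂ := hA.measure_interior_pos
  have h₃ : 0 < ∏ i ∈ Finset.range w.length, c i := Finset.prod_pos fun i _ => hA.pos i
  rw [h, interior_empty, measureReal_empty] at h₁
  exact absurd h₁ (by positivity)

theorem IsFamily.exists_point (hA : IsData J n c) (hK : IsFamily J n c K) (ω : ∀ i, Fin (n i)) :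
    ∃ x, ∀ k, x ∈ K (toWord (firstLetters k ω)) := by
  have h := IsCompact.nonempty_iInter_of_sequence_nonempty_isCompact_isClosed
    (fun k => K (toWord (firstLetters k ω)))
    (fun k => by
      have h₁ := hK.subset _ (isWord_toWord (firstLetters k ω)) (ω k)
        (by rw [length_toWord]; exact (ω k).2)
      rwa [← toWord_firstLetters_succ] at h₁)
    (fun k => hK.nonempty hA (isWord_toWord _)) (hK.isCompact hA _ (isWord_toWord _))
    (fun k => (hK.isCompact hA _ (isWord_toWord _)).isClosed)
  obtain ⟨x, hx⟩ := h
  exact ⟨x, Set.mem_iInter.1 hx⟩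

theorem IsFamily.dist_lt (hA : IsData J n c) (hK : IsFamily J n c K) {r : ℝ} (hr : 0 < r)
    {τ : ∀ i : Fin (order J c r), Fin (n i)} {x y : EuclideanSpace ℝ (Fin p)}
    (hx : x ∈ K (toWord τ)) (hy : y ∈ K (toWord τ)) : dist x y < r := by
  refine (Metric.dist_le_diam_of_mem (hK.isCompact hA _ (isWord_toWord τ)).isBounded hx hy).trans_lt
    ?_
  rw [hK.diam_eq hA _ (isWord_toWord τ), length_toWord]
  exact hK.order_spec hA hr

/-- The elements in question have diameter below `r`, so those meeting the ball lie in the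
concentric ball of radius `2 * r`, where their disjoint interiors compete for volume. -/
theorem IsFamily.card_le (hA : IsData J n c) (hK : IsFamily J n c K) {r : ℝ} (hr : 0 < r)
    (x : EuclideanSpace ℝ (Fin p)) (W : Finset (∀ i : Fin (order J c r), Fin (n i)))
    (hW : ∀ τ ∈ W, (K (toWord τ) ∩ Metric.closedBall x r).Nonempty) :
    W.card * ((∏ i ∈ Finset.range (order J c r), c i) ^ p * (topMeasure p).real (interior J)) ≤
      (2 * r) ^ p * (topMeasure p).real (Metric.ball 0 1) := by
  have h₁ : (topMeasure p).real (⋃ τ ∈ W, interior (K (toWord τ))) =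
      ∑ τ ∈ W, (topMeasure p).real (interior (K (toWord τ))) := by
    refine measureReal_biUnion_finset ?_ (fun i _ => isOpen_interior.measurableSet) ?_
    · intro τ _ τ' _ hne
      exact hK.disjoint_interior _ _ (isWord_toWord τ) (isWord_toWord τ')
        (by simp only [length_toWord]) (toWord_injective.ne hne)
    · intro τ _
      exact ((measure_mono interior_subset).trans_lt
        (hK.isCompact hA _ (isWord_toWord τ)).measure_lt_top).ne
  have h₂ : (topMeasure p).real (⋃ τ ∈ W, interior (K (toWord τ))) ≤
      (topMeasure p).real (Metric.closedBall x (2 * r)) := by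
    refine measureReal_mono (Set.iUnion₂_subset fun τ hτ => interior_subset.trans ?_)
      measure_closedBall_lt_top.ne
    intro y hy
    obtain ⟨z, hz, hzx⟩ := hW τ hτ
    rw [Metric.mem_closedBall] at hzx ⊢
    linarith [dist_triangle y z x, hK.dist_lt hA hr hy hz]
  rw [h₁, Finset.sum_congr rfl fun τ _ => hK.measure_interior hA _ (isWord_toWord τ)] at h₂
  simp only [length_toWord, Finset.sum_const, nsmul_eq_mul] at h₂
  refine h₂.trans_eq ?_
  rw [measureReal_def, measureReal_def, addHaar_closedBall _ _ (by positivity), ENNReal.toReal_mul,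
    ENNReal.toReal_ofReal (by positivity), finrank_euclideanSpace_fin]

theorem IsFamily.exists_card_le (hA : IsData J n c) (hK : IsFamily J n c K) :
    ∃ C : ℝ, 1 ≤ C ∧ ∀ r, 0 < r → 0 < order J c r → ∀ (x : EuclideanSpace ℝ (Fin p))
      (W : Finset (∀ i : Fin (order J c r), Fin (n i))),
      (∀ τ ∈ W, (K (toWord τ) ∩ Metric.closedBall x r).Nonempty) → (W.card : ℝ) ≤ C := by
  obtain ⟨a, b, M, ha, hb, hM, hab⟩ := hK.exists_bounds hA
  have hV := hA.measure_interior_pos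
  have hD := hK.diam_pos hA
  refine ⟨max 1 ((2 * (Metric.diam J * Real.exp b)) ^ p * (topMeasure p).real (Metric.ball 0 1) /
    (topMeasure p).real (interior J)), le_max_left _ _, ?_⟩
  intro r hr hk x W hW
  refine le_trans ?_ (le_max_right _ _)
  have h := hK.card_le hA hr x W hW
  obtain ⟨l, hl⟩ : ∃ l, order J c r = l + 1 := ⟨order J c r - 1, by omega⟩
  set P := ∏ i ∈ Finset.range (order J c r), c i with hP
  have hPpos : 0 < P := Finset.prod_pos fun i _ => hA.pos i
  have hrl := le_of_lt_order (J := J) (c := c) (r := r) (j := l) (by omega)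
  have hPl : ∏ i ∈ Finset.range l, c i ≤ P * Real.exp b := by
    have h₀ : 0 < ∏ i ∈ Finset.range l, c i := Finset.prod_pos fun i _ => hA.pos i
    rw [hP, hl, Finset.prod_range_succ, mul_assoc]
    refine le_mul_of_one_le_right h₀.le ?_
    have h₁ : Real.exp (-b) ≤ c l := by
      rw [← Real.exp_log (hA.pos l)]
      exact Real.exp_le_exp.2 (by linarith [(hab l).2.1])
    calc (1 : ℝ) = Real.exp (-b) * Real.exp b := by rw [← Real.exp_add]; simp
      _ ≤ _ := by gcongr
  -- One level changes sizes by a factor of at most `exp b`, so the elements are not much smaller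
  -- than `r`; the powers of `P` then cancel from the volume estimate.
  have hr' : r ≤ P * (Metric.diam J * Real.exp b) :=
    hrl.trans ((mul_le_mul_of_nonneg_right hPl hD.le).trans_eq (by ring))
  rw [le_div_iff₀ hV]
  have h₂ : (2 * r) ^ p * (topMeasure p).real (Metric.ball 0 1) ≤
      (2 * (P * (Metric.diam J * Real.exp b))) ^ p * (topMeasure p).real (Metric.ball 0 1) := by
    gcongr
  have h₃ := h.trans h₂
  rw [mul_left_comm 2 P, mul_pow] at h₃
  have h₄ : P ^ p * (W.card * (topMeasure p).real (interior J)) ≤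
      P ^ p * ((2 * (Metric.diam J * Real.exp b)) ^ p * (topMeasure p).real (Metric.ball 0 1)) := by
    linarith
  exact le_of_mul_le_mul_left h₄ (by positivity)

/-- Neither injectivity nor surjectivity is needed, as the map only transports the word measure.
Continuity holds because words with a long common prefix are sent into one small basic element. -/
theorem IsFamily.exists_coding (hA : IsData J n c) (hK : IsFamily J n c K) :
    ∃ f : (∀ i, Fin (n i)) → limitSet n K, Continuous f ∧
      ∀ ω k, (f ω : EuclideanSpace ℝ (Fin p)) ∈ K (toWord (firstLetters k ω)) := by
  choose f hf using hK.exists_point hA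
  refine ⟨fun ω => ⟨f ω, Set.mem_iInter.2 fun k => Set.mem_iUnion₂.2
    ⟨_, ⟨isWord_toWord _, length_toWord _⟩, hf ω k⟩⟩, ?_, hf⟩
  refine Continuous.subtype_mk (Metric.continuous_iff'.2 fun ω ε hε => ?_) _
  filter_upwards [(isOpen_setOf_firstLetters_eq (firstLetters (order J c ε) ω)).mem_nhds rfl]
    with ω' hω'
  have h := hf ω' (order J c ε)
  rw [hω'] at h
  exact hK.dist_lt hA hε h (hf ω _)

/-- With `k` the order of `r`, every cylinder of length `k` has mass `1 / Φ r`. The ball receives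
the whole cylinder of an element containing its centre, and its preimage is covered by the boundedly
many cylinders whose elements meet it. -/
theorem IsFamily.exists_isGauge (hA : IsData J n c) (hK : IsFamily J n c K) :
    ∃ (μ : Measure (limitSet n K)) (C : ℝ), IsProbabilityMeasure μ ∧ 1 ≤ C ∧
      IsGauge μ (Phi J n c) C := by
  obtain ⟨f, hf, hfK⟩ := hK.exists_coding hA
  obtain ⟨C, hC, hcard⟩ := hK.exists_card_le hA
  have := isProbabilityMeasure_wordMeasure hA.two_le
  have hμ : IsProbabilityMeasure ((wordMeasure n).map f) :=
    Measure.isProbabilityMeasure_map hf.measurable.aemeasurable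
  refine ⟨(wordMeasure n).map f, C, hμ, hC, ⟨?_, ?_⟩⟩
  · intro x r hr
    rw [map_measureReal_apply hf.measurable Metric.isClosed_closedBall.measurableSet]
    obtain ⟨w, ⟨hw, hwk⟩, hxw⟩ := Set.mem_iUnion₂.1 (Set.mem_iInter.1 x.2 (order J c r))
    obtain ⟨τ, rfl⟩ : ∃ τ : ∀ i : Fin (order J c r), Fin (n i), toWord τ = w := by
      rw [← hwk]; exact exists_toWord_eq hw
    have h₁ : {ω | firstLetters (order J c r) ω = τ} ⊆ f ⁻¹' Metric.closedBall x r := by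
      rintro ω rfl
      rw [Set.mem_preimage, Metric.mem_closedBall]
      exact (hK.dist_lt hA hr (hfK ω _) hxw).le
    have h₂ := measureReal_mono (μ := wordMeasure n) h₁
    rw [wordMeasure_firstLetters hA.two_le] at h₂
    change (Phi J n c r)⁻¹ ≤ _ at h₂
    rwa [inv_le_iff_one_le_mul₀' (lt_of_lt_of_le one_pos (one_le_Phi hA r))] at h₂
  · intro x r hr
    rcases Nat.eq_zero_or_pos (order J c r) with h0 | hpos
    · rw [Phi, h0, Finset.range_zero, Finset.prod_empty, one_mul]
      exact measureReal_le_one.trans hC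
    rw [map_measureReal_apply hf.measurable Metric.isClosed_closedBall.measurableSet]
    classical
    set W : Finset (∀ i : Fin (order J c r), Fin (n i)) := Finset.univ.filter fun τ =>
      (K (toWord τ) ∩ Metric.closedBall (x : EuclideanSpace ℝ (Fin p)) r).Nonempty with hW
    have hWC := hcard r hr hpos x W fun τ hτ => (Finset.mem_filter.1 hτ).2
    have h₁ : f ⁻¹' Metric.closedBall x r ⊆
        ⋃ τ ∈ W, {ω | firstLetters (order J c r) ω = τ} := by
      intro ω hω
      exact Set.mem_iUnion₂.2 ⟨firstLetters _ ω,
        Finset.mem_filter.2 ⟨Finset.mem_univ _, _, hfK ω _, hω⟩, rfl⟩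
    have h₂ := (measureReal_mono (μ := wordMeasure n) h₁ (measure_ne_top _ _)).trans
      (measureReal_biUnion_finset_le _ _)
    rw [Finset.sum_congr rfl fun τ _ => wordMeasure_firstLetters hA.two_le τ, Finset.sum_const,
      nsmul_eq_mul] at h₂
    change _ ≤ _ * (Phi J n c r)⁻¹ at h₂
    have hΦ := lt_of_lt_of_le one_pos (one_le_Phi (J := J) hA r)
    rw [← div_eq_mul_inv, le_div_iff₀ hΦ, mul_comm] at h₂
    exact h₂.trans hWC

end Measure

/-! ### Counting separated sets by measure. -/

section Packing

variable {X : Type*} [MetricSpace X] [MeasurableSpace X] [BorelSpace X] {μ : Measure X}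
  [IsProbabilityMeasure μ] {Φ : ℝ → ℝ} {C s K R : ℝ}

theorem IsRegular.pos (hΦ : IsRegular Φ s K R) (r : ℝ) : 0 < Φ r :=
  lt_of_lt_of_le one_pos (hΦ.one_le r)

/-- Balls of radius `r / 3` about the points are disjoint, and each has mass at least `1 / Φ (r /
3)`. -/
theorem IsGauge.card_le_of_subset_ball (hμ : IsGauge μ Φ C) (hΦ : IsRegular Φ s K R)
    (T : Finset X) {x₀ : X} {ρ r : ℝ} (hr : 0 < r) (hT : ∀ x ∈ T, dist x x₀ ≤ ρ)
    (hsep : ∀ x ∈ T, ∀ y ∈ T, x ≠ y → r ≤ dist x y) :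
    (T.card : ℝ) ≤ Φ (r / 3) * μ.real (Metric.closedBall x₀ (ρ + r)) := by
  have h₁ : μ.real (⋃ x ∈ T, Metric.closedBall x (r / 3)) =
      ∑ x ∈ T, μ.real (Metric.closedBall x (r / 3)) := by
    refine measureReal_biUnion_finset ?_ fun x _ => Metric.isClosed_closedBall.measurableSet
    intro x hx y hy hxy
    refine Metric.closedBall_disjoint_closedBall ?_
    linarith [hsep x hx y hy hxy]
  have h₂ : μ.real (⋃ x ∈ T, Metric.closedBall x (r / 3)) ≤
      μ.real (Metric.closedBall x₀ (ρ + r)) := by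
    refine measureReal_mono (Set.iUnion₂_subset fun x hx => ?_) (measure_ne_top _ _)
    exact Metric.closedBall_subset_closedBall' (by linarith [hT x hx])
  have h₃ : ∑ x ∈ T, (1 : ℝ) ≤ ∑ x ∈ T, Φ (r / 3) * μ.real (Metric.closedBall x (r / 3)) :=
    Finset.sum_le_sum fun x _ => hμ.lower x _ (by positivity)
  rw [← Finset.mul_sum, ← h₁, Finset.sum_const, nsmul_eq_mul, mul_one] at h₃
  exact h₃.trans (mul_le_mul_of_nonneg_left h₂ (hΦ.pos _).le)

theorem IsGauge.card_le (hμ : IsGauge μ Φ C) (hΦ : IsRegular Φ s K R)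
    (T : Finset X) {r : ℝ} (hr : 0 < r)
    (hsep : ∀ x ∈ T, ∀ y ∈ T, x ≠ y → r ≤ dist x y) : (T.card : ℝ) ≤ Φ (r / 3) := by
  rcases T.eq_empty_or_nonempty with rfl | ⟨x₀, hx₀⟩
  · simpa using (hΦ.pos (r / 3)).le
  have h := hμ.card_le_of_subset_ball hΦ T hr (x₀ := x₀) (ρ := T.sup' ⟨x₀, hx₀⟩ fun x => dist x x₀)
    (fun x hx => Finset.le_sup' (fun x => dist x x₀) hx) hsep
  exact h.trans (mul_le_of_le_one_right (hΦ.pos _).le measureReal_le_one)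

/-- A separated set of maximal cardinality exists by `IsGauge.card_le`; by maximality the `r`-balls
about its points cover the given ball. -/
theorem IsGauge.exists_separated (hμ : IsGauge μ Φ C) (hΦ : IsRegular Φ s K R)
    (x₀ : X) (ρ : ℝ) {r : ℝ} (hr : 0 < r) :
    ∃ T : Finset X, (∀ x ∈ T, dist x x₀ ≤ ρ) ∧ (∀ x ∈ T, ∀ y ∈ T, x ≠ y → r ≤ dist x y) ∧
      Φ r * μ.real (Metric.closedBall x₀ ρ) ≤ C * T.card := by
  classical
  set N : Set ℕ := {k | ∃ T : Finset X, T.card = k ∧ (∀ x ∈ T, dist x x₀ ≤ ρ) ∧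
    ∀ x ∈ T, ∀ y ∈ T, x ≠ y → r ≤ dist x y} with hN
  have hbdd : BddAbove N := by
    refine ⟨⌊Φ (r / 3)⌋₊, ?_⟩
    rintro _ ⟨T, rfl, -, hT⟩
    exact Nat.le_floor (hμ.card_le hΦ T hr hT)
  have hne : N.Nonempty := ⟨0, ∅, by simp⟩
  obtain ⟨T, hcard, hball, hsep⟩ := Nat.sSup_mem hne hbdd
  refine ⟨T, hball, hsep, ?_⟩
  have hcov : Metric.closedBall x₀ ρ ⊆ ⋃ x ∈ T, Metric.closedBall x r := by
    intro z hz
    by_contra hcon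
    simp only [Set.mem_iUnion, Metric.mem_closedBall, exists_prop, not_exists, not_and,
      not_le] at hcon
    have hzT : z ∉ T := fun h => by have := hcon z h; rw [dist_self] at this; linarith
    have hmem : (insert z T).card ∈ N := by
      refine ⟨_, rfl, ?_, ?_⟩
      · intro x hx
        rcases Finset.mem_insert.1 hx with rfl | hx
        · exact hz
        · exact hball x hx
      · intro x hx y hy hxy
        rcases Finset.mem_insert.1 hx with rfl | hx' <;>
          rcases Finset.mem_insert.1 hy with rfl | hy'
        · exact absurd rfl hxy
        · exact (hcon y hy').le
        · rw [dist_comm]; exact (hcon x hx').le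
        · exact hsep x hx' y hy' hxy
    have := le_csSup hbdd hmem
    rw [Finset.card_insert_of_notMem hzT] at this
    omega
  have h₁ := (measureReal_mono (μ := μ) hcov (measure_ne_top _ _)).trans
    (measureReal_biUnion_finset_le _ _)
  have h₂ : ∑ x ∈ T, Φ r * μ.real (Metric.closedBall x r) ≤ ∑ x ∈ T, C :=
    Finset.sum_le_sum fun x _ => hμ.upper x _ hr
  rw [← Finset.mul_sum, Finset.sum_const, nsmul_eq_mul, mul_comm (T.card : ℝ)] at h₂
  exact (mul_le_mul_of_nonneg_left h₁ (hΦ.pos _).le).trans h₂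

end Packing

/-! ### Uniform disconnectedness from growth of slope less than one. -/

theorem exists_nat_mul_log_gt {a : ℝ} (ha : 0 < a) (b : ℝ) :
    ∃ M : ℕ, 1 ≤ M ∧ b < a * Real.log M := by
  have h := (Real.tendsto_log_atTop.comp tendsto_natCast_atTop_atTop).const_mul_atTop ha
  obtain ⟨M, hM⟩ := ((h.eventually_gt_atTop b).and (eventually_ge_atTop 1)).exists
  exact ⟨M, hM.2, hM.1⟩

/-- Consider `M` annuli of width `2 * r` about `x`, with gaps of width `r` between them. If all met
`E`, one point from each would give `M` points that are `r`-separated, so `M ≤ C Φ(r/3) / Φ((3M+2)r)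
≤ C e^L (15 M)^σ`, which fails for large `M` because `σ < 1`. An empty annulus separates the part of
`E` inside it from the rest. -/
theorem uniformlyDisconnected_of_growth {Y : Type*} [MetricSpace Y] [MeasurableSpace Y]
    [BorelSpace Y] {E : Set Y} {μ : Measure E} [IsProbabilityMeasure μ] {Φ : ℝ → ℝ}
    {C s K R : ℝ} (hC : 1 ≤ C) (hμ : IsGauge μ Φ C) (hΦ : IsRegular Φ s K R)
    {σ L R' : ℝ} (hσ : 0 ≤ σ) (hσ₁ : σ < 1) (hR' : 0 < R')
    (hgrow : ∀ r' r, 0 < r' → r' ≤ r → r ≤ R' →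
      Real.log (Φ r') ≤ Real.log (Φ r) + σ * Real.log (r / r') + L) :
    UniformlyDisconnected E := by
  obtain ⟨M, hM₁, hM⟩ := exists_nat_mul_log_gt (sub_pos.2 hσ₁)
    (Real.log C + σ * Real.log 15 + L)
  have hM₁' : (1 : ℝ) ≤ M := by exact_mod_cast hM₁
  refine ⟨3 * M + 1, by linarith, R' / (3 * M + 2), by positivity, ?_⟩
  intro x hx r hr hrR
  rw [lt_div_iff₀ (by positivity)] at hrR
  obtain ⟨j, hj, hgap⟩ : ∃ j < M, ∀ y ∈ E, dist y x ≤ r + 3 * j * r ∨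
      r + 3 * j * r + 2 * r < dist y x := by
    by_contra! hcon
    have : Nonempty Y := ⟨x⟩
    choose! y hyE hy₁ hy₂ using hcon
    classical
    have hinc : ∀ i j, i < j → j < M → r ≤ dist (y i) (y j) := by
      intro i j hij hj
      have h₁ := hy₂ i (hij.trans hj)
      have h₂ := hy₁ j hj
      have h₃ : ((i : ℝ) + 1) ≤ j := by exact_mod_cast hij
      have h₄ := mul_le_mul_of_nonneg_right h₃ hr.le
      have h₅ := dist_triangle_left (y j) x (y i)
      linarith
    have hsep : ∀ i j, i ≠ j → i < M → j < M → r ≤ dist (y i) (y j) := by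
      intro i j hij hi hj
      rcases Nat.lt_or_gt_of_ne hij with h | h
      · exact hinc i j h hj
      · rw [dist_comm]; exact hinc j i h hi
    set g : Fin M → E := fun j => ⟨y j, hyE j j.2⟩ with hg
    have hginj : Function.Injective g := by
      intro i j hij
      by_contra hne
      have h₁ := hsep i j (fun h => hne (Fin.ext h)) i.2 j.2
      have h₂ : y i = y j := congrArg Subtype.val hij
      rw [h₂, dist_self] at h₁
      linarith
    have hcard := hμ.card_le_of_subset_ball hΦ (Finset.univ.image g) (x₀ := ⟨x, hx⟩)
      (ρ := (3 * M + 1) * r) hr ?_ ?_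
    · rw [Finset.card_image_of_injective _ hginj, Finset.card_univ, Fintype.card_fin] at hcard
      have hup := hμ.upper ⟨x, hx⟩ ((3 * M + 1) * r + r) (by positivity)
      have hle : (M : ℝ) * Φ ((3 * M + 1) * r + r) ≤ C * Φ (r / 3) := by
        calc (M : ℝ) * Φ ((3 * M + 1) * r + r)
            ≤ Φ (r / 3) * μ.real (Metric.closedBall ⟨x, hx⟩ ((3 * M + 1) * r + r)) *
              Φ ((3 * M + 1) * r + r) := mul_le_mul_of_nonneg_right hcard (hΦ.pos _).le
          _ = Φ (r / 3) * (Φ ((3 * M + 1) * r + r) *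
              μ.real (Metric.closedBall ⟨x, hx⟩ ((3 * M + 1) * r + r))) := by ring
          _ ≤ Φ (r / 3) * C := mul_le_mul_of_nonneg_left hup (hΦ.pos _).le
          _ = C * Φ (r / 3) := mul_comm _ _
      have hp₁ := hΦ.pos ((3 * M + 1) * r + r)
      have hp₂ := hΦ.pos (r / 3)
      have hlog := Real.log_le_log (by positivity) hle
      rw [Real.log_mul (by positivity) hp₁.ne', Real.log_mul (by positivity) hp₂.ne'] at hlog
      have hg' := hgrow (r / 3) ((3 * M + 1) * r + r) (by positivity) (by nlinarith)
        (by linarith)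
      have hdiv : ((3 * M + 1) * r + r) / (r / 3) ≤ 15 * M := by
        rw [div_le_iff₀ (by positivity)]
        nlinarith
      have hlog₂ := Real.log_le_log (by positivity) hdiv
      rw [Real.log_mul (by norm_num) (by positivity)] at hlog₂
      have := mul_le_mul_of_nonneg_left hlog₂ hσ
      linarith
    · intro z hz
      obtain ⟨j, -, rfl⟩ := Finset.mem_image.1 hz
      have h₁ := hy₂ j j.2
      have h₃ : ((j : ℕ) : ℝ) + 1 ≤ M := by exact_mod_cast j.2
      have h₄ := mul_le_mul_of_nonneg_right h₃ hr.le
      change dist (y j) x ≤ _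
      linarith
    · intro z hz w hw hne
      obtain ⟨i, -, rfl⟩ := Finset.mem_image.1 hz
      obtain ⟨j, -, rfl⟩ := Finset.mem_image.1 hw
      exact hsep i j (fun h => hne (congrArg g (Fin.ext h))) i.2 j.2
  have hj' : (j : ℝ) + 1 ≤ M := by exact_mod_cast hj
  have hj'' := mul_le_mul_of_nonneg_right hj' hr.le
  refine ⟨E ∩ Metric.closedBall x (r + 3 * j * r), Set.inter_subset_left, ?_, ?_, ?_⟩
  · exact Set.inter_subset_inter_right _
      (Metric.closedBall_subset_closedBall (le_add_of_nonneg_right (by positivity)))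
  · exact Set.inter_subset_right.trans (Metric.closedBall_subset_closedBall (by linarith))
  · refine lt_of_lt_of_le (ENNReal.ofReal_lt_ofReal_iff_of_nonneg hr.le |>.2
      (by linarith : r < 2 * r)) (le_iInf₂ fun y hy => le_iInf₂ fun z hz => ?_)
    rw [edist_dist]
    refine ENNReal.ofReal_le_ofReal ?_
    have h₁ : dist y x ≤ r + 3 * j * r := hy.2
    have h₂ : r + 3 * j * r + 2 * r < dist z x := by
      rcases hgap z hz.1 with h | h
      · exact absurd ⟨hz.1, h⟩ hz.2
      · exact h
    linarith [dist_triangle_left z x y]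

/-! ### Chain components of uniformly disconnected sets. -/

section Cells

variable {X : Type*} [MetricSpace X]

/-- The set of all points that can be joined to `x` by a chain with steps at most `r`. -/
def cell (r : ℝ) (x : X) : Set X :=
  {y | Relation.ReflTransGen (fun a b => dist a b ≤ r) x y}

theorem mem_cell_self (r : ℝ) (x : X) : x ∈ cell r x := Relation.ReflTransGen.refl

theorem mem_cell_symm {r : ℝ} {x y : X} (h : y ∈ cell r x) : x ∈ cell r y := by
  induction h with
  | refl => exact mem_cell_self _ _
  | tail _ hbc ih => exact Relation.ReflTransGen.head (by rwa [dist_comm]) ih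

theorem cell_eq_of_mem {r : ℝ} {x y : X} (h : y ∈ cell r x) : cell r y = cell r x :=
  Set.Subset.antisymm (fun _ hz => Relation.ReflTransGen.trans h hz)
    fun _ hz => Relation.ReflTransGen.trans (mem_cell_symm h) hz

theorem cell_mono {r r' : ℝ} (h : r' ≤ r) (x : X) : cell r' x ⊆ cell r x :=
  fun _ hy => Relation.ReflTransGen.mono (p := fun a b => dist a b ≤ r)
    (fun _ _ (hab : dist _ _ ≤ r') => hab.trans h) _ _ hy

theorem closedBall_subset_cell (r : ℝ) (x : X) : Metric.closedBall x r ⊆ cell r x :=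
  fun y hy => Relation.ReflTransGen.single (by rw [dist_comm]; exact hy)

theorem lt_dist_of_notMem_cell {r : ℝ} {x y : X} (h : y ∉ cell r x) : r < dist x y :=
  not_le.1 fun hle => h (Relation.ReflTransGen.single hle)

theorem isOpen_of_cell_subset {r : ℝ} (hr : 0 < r) {U : Set X} (hU : ∀ x ∈ U, cell r x ⊆ U) :
    IsOpen U :=
  Metric.isOpen_iff.2 fun x hx =>
    ⟨r, hr, Metric.ball_subset_closedBall.trans ((closedBall_subset_cell r x).trans (hU x hx))⟩

theorem isClosed_of_cell_subset {r : ℝ} (hr : 0 < r) {U : Set X} (hU : ∀ x ∈ U, cell r x ⊆ U) :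
    IsClosed U :=
  ⟨isOpen_of_cell_subset hr fun _ hx y hy hyU => hx (hU y hyU (mem_cell_symm hy))⟩

/-- Cells of small scales have diameters comparable to the scale. -/
def HasSmallCells (X : Type*) [MetricSpace X] (C R : ℝ) : Prop :=
  ∀ (x : X) (r : ℝ), 0 < r → r < R → ∀ y ∈ cell r x, dist x y ≤ C * r

/-- A chain with steps at most `r` that starts in `S` cannot leave it, since the complement of `S`
in `E` is at distance greater than `r`. Thus the cell lies in `S`. -/
theorem UniformlyDisconnected.hasSmallCells {E : Set X} (h : UniformlyDisconnected E) :
    ∃ C R : ℝ, 1 < C ∧ 0 < R ∧ HasSmallCells E C R := by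
  obtain ⟨C, hC, R, hR, h⟩ := h
  refine ⟨C, R, hC, hR, fun x r hr hrR y hy => ?_⟩
  obtain ⟨S, hSE, hS₁, hS₂, hsep⟩ := h x x.2 r hr hrR
  have hyS : (y : X) ∈ S := by
    refine Relation.ReflTransGen.head_induction_on
      (motive := fun (a : E) _ => (a : X) ∈ S → (y : X) ∈ S) hy id ?_
      (hS₁ ⟨x.2, Metric.mem_closedBall_self hr.le⟩)
    intro a b hab _ ih ha
    refine ih ?_
    by_contra hb
    have h₁ : ⨅ y ∈ S, ⨅ z ∈ E \ S, edist y z ≤ edist (a : X) b :=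
      (iInf₂_le _ ha).trans (iInf₂_le _ ⟨b.2, hb⟩)
    have h₂ := hsep.trans_le h₁
    rw [edist_dist] at h₂
    exact absurd (ENNReal.ofReal_le_ofReal (hab : dist (a : X) b ≤ r)) (not_le.2 h₂)
  have := hS₂ hyS
  rw [Metric.mem_closedBall, dist_comm] at this
  exact this

end Cells

/-! ### Bilipschitz embedding by matching nested partitions. -/

/-- Representatives of `M + 1` distinct classes would form a set `T` that is too large. Labels are
attached to classes rather than points, so that the maps built from them are constant on cells. -/
theorem exists_index {X : Type*} (cl : X → Set X) (U : Set X) (M : ℕ)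
    (h : ∀ T : Finset X, (∀ x ∈ T, x ∈ U) → (∀ x ∈ T, ∀ y ∈ T, x ≠ y → cl x ≠ cl y) →
      T.card ≤ M) :
    ∃ g : Set X → ℕ, Set.InjOn g (cl '' U) ∧ ∀ s ∈ cl '' U, g s < M := by
  classical
  have hle : (cl '' U).encard ≤ M := by
    by_contra hlt
    have h₁ : ((M + 1 : ℕ) : ℕ∞) ≤ (cl '' U).encard := by
      rw [Nat.cast_add_one]
      exact Order.add_one_le_of_lt (not_le.1 hlt)
    obtain ⟨t, ht, htc⟩ := Set.exists_subset_encard_eq h₁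
    have htfin : t.Finite := Set.finite_of_encard_eq_coe htc
    have hX : Nonempty X := by
      have hne : t.Nonempty := by
        rw [← Set.encard_ne_zero, htc]
        exact_mod_cast Nat.succ_ne_zero M
      obtain ⟨s, hs⟩ := hne
      obtain ⟨x, -, -⟩ := ht hs
      exact ⟨x⟩
    choose! f hfU hf using ht
    have hcard := h (htfin.toFinset.image f) ?_ ?_
    · rw [Finset.card_image_of_injOn] at hcard
      · rw [htfin.encard_eq_coe_toFinset_card, Nat.cast_inj] at htc
        omega
      · intro a ha b hb hab
        rw [← hf (htfin.mem_toFinset.1 ha), ← hf (htfin.mem_toFinset.1 hb)]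
        exact congrArg cl hab
    · intro x hx
      obtain ⟨s, hs, rfl⟩ := Finset.mem_image.1 hx
      exact hfU (htfin.mem_toFinset.1 hs)
    · intro x hx y hy hxy hcl
      obtain ⟨s, hs, rfl⟩ := Finset.mem_image.1 hx
      obtain ⟨s', hs', rfl⟩ := Finset.mem_image.1 hy
      rw [hf (htfin.mem_toFinset.1 hs), hf (htfin.mem_toFinset.1 hs')] at hcl
      exact hxy (congrArg f hcl)
  have hfin : (cl '' U).Finite := Set.finite_of_encard_le_coe hle
  have := hfin.fintype
  rw [Set.encard_eq_coe_toFinset_card, Nat.cast_le, Set.toFinset_card] at hle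
  obtain ⟨e⟩ := Function.Embedding.nonempty_of_card_le (α := cl '' U) (β := Fin M)
    (by simpa using hle)
  refine ⟨fun s => if hs : s ∈ cl '' U then e ⟨s, hs⟩ else 0, ?_, ?_⟩
  · intro a ha b hb hab
    simp only [dif_pos ha, dif_pos hb] at hab
    exact congrArg Subtype.val (e.injective (Fin.ext hab))
  · intro s hs
    simp only [dif_pos hs]
    exact (e ⟨s, hs⟩).2

theorem exists_enum_of_le_card {Y : Type*} [Nonempty Y] (T : Finset Y) {M : ℕ} (h : M ≤ T.card) :
    ∃ t : ℕ → Y, (∀ i < M, t i ∈ T) ∧ ∀ i < M, ∀ j < M, i ≠ j → t i ≠ t j := by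
  classical
  refine ⟨fun i => if hi : i < T.card then T.equivFin.symm ⟨i, hi⟩ else Classical.arbitrary Y,
    fun i hi => ?_, fun i hi j hj hij he => hij ?_⟩
  · simp only [dif_pos (hi.trans_le h)]
    exact Subtype.prop _
  · simp only [dif_pos (hi.trans_le h), dif_pos (hj.trans_le h)] at he
    simpa using T.equivFin.symm.injective (Subtype.ext he)

/-- Each cell of level `k` is sent to a point `y k`, its subcells to distinct points of the family
`t` around it, and the embedding is the limit. The tail of the construction moves points by at most
`2 * ρ k`, so the separation `5 * ρ (k + 1)` leaves `ρ (k + 1)` in the limit. For two points first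
separated at level `j + 1`, both distances are therefore comparable to `ρ j`. -/
theorem bilipschitzEmbeds_of_levels {X Y : Type*} [MetricSpace X] [MetricSpace Y] [CompleteSpace Y]
    [Nonempty Y] (ρ : ℕ → ℝ) (hρ : ∀ k, 0 < ρ k) (hρ₄ : ∀ k, 4 * ρ (k + 1) ≤ ρ k) {L C : ℝ}
    (hL : ∀ k, ρ k ≤ L * ρ (k + 1)) (hC : 0 < C) (cl : ℕ → X → Set X)
    (hcl0 : ∀ x y, y ∈ cl 0 x) (hself : ∀ k x, x ∈ cl k x)
    (heq : ∀ k x y, y ∈ cl k x → cl k y = cl k x) (hsub : ∀ k x, cl (k + 1) x ⊆ cl k x)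
    (hdist : ∀ k x y, y ∈ cl k x → dist x y ≤ C * ρ k)
    (hsep : ∀ k x y, y ∉ cl (k + 1) x → ρ (k + 1) ≤ dist x y) (M : ℕ → ℕ)
    (hM : ∀ k x, ∃ g : Set X → ℕ, Set.InjOn g (cl (k + 1) '' cl k x) ∧
      ∀ s ∈ cl (k + 1) '' cl k x, g s < M k)
    (ht : ∀ k (y : Y), ∃ t : ℕ → Y, (∀ i < M k, dist (t i) y ≤ ρ k) ∧
      ∀ i < M k, ∀ j < M k, i ≠ j → 5 * ρ (k + 1) ≤ dist (t i) (t j)) :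
    BilipschitzEmbeds X Y := by
  -- The labelling is re-indexed by the cell itself, so that it does not depend on the point chosen
  -- in it.
  have hM' : ∀ k (U : Set X), ∃ g : Set X → ℕ, ∀ x, cl k x = U →
      Set.InjOn g (cl (k + 1) '' U) ∧ ∀ s ∈ cl (k + 1) '' U, g s < M k := by
    intro k U
    by_cases h : ∃ x, cl k x = U
    · obtain ⟨x, rfl⟩ := h
      obtain ⟨g, hg⟩ := hM k x
      exact ⟨g, fun _ _ => hg⟩
    · exact ⟨fun _ => 0, fun x hx => absurd ⟨x, hx⟩ h⟩
  choose g hg using hM'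
  choose t htd hts using ht
  set idx : ℕ → X → ℕ := fun k x => g k (cl k x) (cl (k + 1) x) with hidx
  have hidx_lt : ∀ k x, idx k x < M k := fun k x =>
    (hg k (cl k x) x rfl).2 _ ⟨x, hself k x, rfl⟩
  have hidx_inj : ∀ k x x', x' ∈ cl k x → idx k x = idx k x' → x' ∈ cl (k + 1) x := by
    intro k x x' hx' he
    have h₁ := (hg k (cl k x) x rfl).1 (x₁ := cl (k + 1) x) ⟨x, hself k x, rfl⟩
      (x₂ := cl (k + 1) x') ⟨x', hx', rfl⟩ (by simpa only [hidx, heq k x x' hx'] using he)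
    rw [h₁]
    exact hself _ _
  let y : ℕ → X → Y := fun k => Nat.rec (fun _ => Classical.arbitrary Y)
    (fun k yk x => t k (yk x) (idx k x)) k
  have hy : ∀ k x, y (k + 1) x = t k (y k x) (idx k x) := fun k x => rfl
  have hycl : ∀ k x x', x' ∈ cl k x → y k x' = y k x := by
    intro k
    induction k with
    | zero => intro x x' _; rfl
    | succ k ih =>
      intro x x' hx'
      have h₁ := hsub k x hx'
      rw [hy, hy, ih x x' h₁]
      simp only [hidx, heq k x x' h₁, heq (k + 1) x x' hx']
  have hstep : ∀ k x, dist (y k x) (y (k + 1) x) ≤ ρ k := fun k x => by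
    rw [hy, dist_comm]
    exact htd k _ _ (hidx_lt k x)
  have hρgeo : ∀ k, ρ k ≤ ρ 0 * (1 / 4) ^ k := by
    intro k
    induction k with
    | zero => simp
    | succ k ih => rw [pow_succ]; linarith [hρ₄ k]
  have hρlim : Tendsto ρ atTop (𝓝 0) := by
    refine squeeze_zero (fun k => (hρ k).le) hρgeo ?_
    simpa using (tendsto_pow_atTop_nhds_zero_of_lt_one (r := (1 / 4 : ℝ)) (by norm_num)
      (by norm_num)).const_mul (ρ 0)
  have hlong : ∀ m k x, dist (y k x) (y (k + m) x) ≤ 2 * ρ k := by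
    intro m
    induction m with
    | zero => intro k x; simpa using (hρ k).le
    | succ m ih =>
      intro k x
      have h₁ := ih (k + 1) x
      rw [add_right_comm, add_assoc] at h₁
      linarith [dist_triangle (y k x) (y (k + 1) x) (y (k + (m + 1)) x), hstep k x, hρ₄ k, hρ k]
  have hlim : ∀ x, ∃ z, Tendsto (fun k => y k x) atTop (𝓝 z) := fun x =>
    cauchySeq_tendsto_of_complete (cauchySeq_of_le_geometric (1 / 4) (ρ 0) (by norm_num)
      fun k => (hstep k x).trans (hρgeo k))
  choose f hf using hlim
  have hyf : ∀ k x, dist (y k x) (f x) ≤ 2 * ρ k := by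
    intro k x
    refine le_of_tendsto (tendsto_const_nhds.dist (hf x)) ?_
    filter_upwards [eventually_ge_atTop k] with m hm
    obtain ⟨e, rfl⟩ := Nat.exists_eq_add_of_le hm
    exact hlong e k x
  have hLpos : 0 < L := by
    have h₁ := (hρ 0).trans_le (hL 0)
    exact pos_of_mul_pos_left h₁ (hρ 1).le
  have key : ∀ x x', x ≠ x' → dist (f x) (f x') ≤ 4 * L * dist x x' ∧
      dist x x' ≤ C * L * dist (f x) (f x') := by
    intro x x' hne
    have hex : ∃ k, x' ∉ cl k x := by
      by_contra! hcon
      have h₁ : dist x x' ≤ 0 := by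
        refine ge_of_tendsto' (f := fun k => C * ρ k) (by simpa using hρlim.const_mul C) ?_
        exact fun k => hdist k x x' (hcon k)
      exact hne (dist_le_zero.1 h₁)
    classical
    obtain ⟨j, hj⟩ : ∃ j, Nat.find hex = j + 1 := by
      refine Nat.exists_eq_succ_of_ne_zero fun h0 => ?_
      have := Nat.find_spec hex
      rw [h0] at this
      exact this (hcl0 _ _)
    have h₁ : x' ∉ cl (j + 1) x := hj ▸ Nat.find_spec hex
    have h₂ : x' ∈ cl j x := not_not.1 (Nat.find_min hex (by omega))
    have h₃ : idx j x ≠ idx j x' := fun he => h₁ (hidx_inj j x x' h₂ he)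
    have h₄ := hts j (y j x) _ (hidx_lt j x) _ (hidx_lt j x') h₃
    rw [← hy, ← hycl j x x' h₂, ← hy] at h₄
    have h₅ := hyf (j + 1) x
    have h₆ := hyf (j + 1) x'
    have h₇ : ρ (j + 1) ≤ dist (f x) (f x') := by
      have := dist_triangle4 (y (j + 1) x) (f x) (f x') (y (j + 1) x')
      rw [dist_comm (f x') _] at this
      linarith
    have h₈ : dist (f x) (f x') ≤ 4 * ρ j := by
      have := dist_triangle_left (f x) (f x') (y j x)
      have h₉ := hyf j x'
      rw [hycl j x x' h₂] at h₉
      linarith [hyf j x]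
    have h₉ := hsep j x x' h₁
    have h₁₀ := hdist j x x' h₂
    have h₁₁ := hL j
    constructor
    · nlinarith
    · have : L * ρ (j + 1) ≤ L * dist (f x) (f x') := mul_le_mul_of_nonneg_left h₇ hLpos.le
      nlinarith
  refine ⟨f, ?_, max 1 (max (4 * L) (C * L)), le_max_left _ _, ?_⟩
  · intro x x' he
    by_contra hne
    have h₁ := (key x x' hne).2
    rw [he, dist_self, mul_zero] at h₁
    exact hne (dist_le_zero.1 h₁)
  · intro x x'
    by_cases hne : x = x'
    · subst hne
      simp
    have hpos : 0 < max 1 (max (4 * L) (C * L)) := lt_of_lt_of_le one_pos (le_max_left _ _)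
    obtain ⟨h₁, h₂⟩ := key x x' hne
    refine ⟨?_, h₁.trans ?_⟩
    · rw [div_le_iff₀ hpos, mul_comm]
      refine h₂.trans ?_
      gcongr
      exact (le_max_right _ _).trans (le_max_right _ _)
    · gcongr
      exact (le_max_left _ _).trans (le_max_right _ _)

section Embedding

variable {X : Type*} [MetricSpace X] [MeasurableSpace X] [BorelSpace X] {μ : Measure X}
  [IsProbabilityMeasure μ] {Φ : ℝ → ℝ} {C s K R : ℝ}

theorem IsRegular.log_nonneg (hΦ : IsRegular Φ s K R) (r : ℝ) : 0 ≤ Real.log (Φ r) :=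
  Real.log_nonneg (hΦ.one_le r)

theorem IsRegular.log_le_mul (hΦ : IsRegular Φ s K R) {a r : ℝ} (ha : 1 ≤ a) (hr : 0 < r) :
    Real.log (Φ r) ≤ Real.log (Φ (a * r)) + K * (1 + Real.log a) := by
  have := hΦ.upper r (a * r) hr (le_mul_of_one_le_left hr.le ha)
  rwa [mul_div_cancel_right₀ _ hr.ne'] at this

theorem IsRegular.log_div_le (hΦ : IsRegular Φ s K R) {a r : ℝ} (ha : 1 ≤ a) (hr : 0 < r) :
    Real.log (Φ (r / a)) ≤ Real.log (Φ r) + K * (1 + Real.log a) := by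
  have h := hΦ.log_le_mul (r := r / a) ha (by positivity)
  rwa [mul_div_cancel₀ _ (by positivity : a ≠ 0)] at h

theorem IsRegular.le_log_div (hΦ : IsRegular Φ s K R) {a r : ℝ} (ha : 1 ≤ a) (hr : 0 < r)
    (hrR : r ≤ R) : Real.log (Φ r) + s * Real.log a - K ≤ Real.log (Φ (r / a)) := by
  have h := hΦ.lower (r / a) r (by positivity) (div_le_self hr.le ha) hrR
  rwa [div_div_cancel₀ hr.ne'] at h

theorem IsGauge.card_le_of_cells (hμ : IsGauge μ Φ C) (hΦ : IsRegular Φ s K R) {C₁ R₁ : ℝ}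
    (hcell : HasSmallCells X C₁ R₁) {r r' : ℝ} (hr' : 0 < r') (hrr : r' ≤ r) (hrR : r < R₁)
    (hC₁ : 0 < C₁) (x : X) (T : Finset X) (hT : ∀ y ∈ T, y ∈ cell r x)
    (hsep : ∀ y ∈ T, ∀ z ∈ T, y ≠ z → cell r' y ≠ cell r' z) :
    (T.card : ℝ) ≤ C * Φ (r' / 3) / Φ ((C₁ + 1) * r) := by
  have hr := hr'.trans_le hrr
  have h := hμ.card_le_of_subset_ball hΦ T (x₀ := x) (ρ := C₁ * r) hr'
    (fun y hy => by rw [dist_comm]; exact hcell x r hr hrR y (hT y hy))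
    (fun y hy z hz hne => (lt_dist_of_notMem_cell fun hmem =>
      hsep y hy z hz hne (cell_eq_of_mem hmem).symm).le)
  have h₁ : μ.real (Metric.closedBall x (C₁ * r + r')) ≤
      μ.real (Metric.closedBall x ((C₁ + 1) * r)) :=
    measureReal_mono (Metric.closedBall_subset_closedBall (by linarith)) (measure_ne_top _ _)
  have h₂ := hμ.upper x ((C₁ + 1) * r) (by positivity)
  rw [le_div_iff₀ (hΦ.pos _)]
  calc (T.card : ℝ) * Φ ((C₁ + 1) * r)
      ≤ Φ (r' / 3) * μ.real (Metric.closedBall x ((C₁ + 1) * r)) * Φ ((C₁ + 1) * r) :=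
        mul_le_mul_of_nonneg_right (h.trans (mul_le_mul_of_nonneg_left h₁ (hΦ.pos _).le))
          (hΦ.pos _).le
    _ = Φ (r' / 3) * (Φ ((C₁ + 1) * r) * μ.real (Metric.closedBall x ((C₁ + 1) * r))) := by ring
    _ ≤ Φ (r' / 3) * C := mul_le_mul_of_nonneg_left h₂ (hΦ.pos _).le
    _ = C * Φ (r' / 3) := mul_comm _ _

theorem IsGauge.exists_separated_of_le (hμ : IsGauge μ Φ C) (hΦ : IsRegular Φ s K R) (hC : 0 < C)
    [Nonempty X] (x : X) (ρ : ℝ) {r β : ℝ} (hr : 0 < r) (hβ : 0 ≤ β)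
    (h : C * β ≤ Φ r * μ.real (Metric.closedBall x ρ)) :
    ∃ t : ℕ → X, (∀ i < ⌊β⌋₊, dist (t i) x ≤ ρ) ∧
      ∀ i < ⌊β⌋₊, ∀ j < ⌊β⌋₊, i ≠ j → r ≤ dist (t i) (t j) := by
  obtain ⟨T, hT, hsep, hcard⟩ := hμ.exists_separated hΦ x ρ hr
  have h₁ : β ≤ T.card := le_of_mul_le_mul_left (h.trans hcard) hC
  obtain ⟨t, ht, hinj⟩ := exists_enum_of_le_card T
    (by exact_mod_cast (Nat.floor_le hβ).trans h₁ : ⌊β⌋₊ ≤ T.card)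
  exact ⟨t, fun i hi => hT _ (ht i hi),
    fun i hi j hj hij => hsep _ (ht i hi) _ (ht j hj) (hinj i hi j hj hij)⟩

/-- Between scales `r` and `r / N`, the logarithm of the room in `Y` exceeds that of the number of
subcells in `X` by `(1 - α) * (log Ψ(r/N) - log Ψ(r))` minus constants. Lower regularity of `Ψ`
makes this at least `(1 - α) * (s' * log N - K')` minus constants, which is positive for large `N`.
-/
theorem bilipschitzEmbeds_of_gauge [CompactSpace X] {Y : Type*} [MetricSpace Y]
    [MeasurableSpace Y] [BorelSpace Y] [CompactSpace Y] {ν : Measure Y} [IsProbabilityMeasure ν]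
    {Ψ : ℝ → ℝ} {C' s' K' R' : ℝ} (hC : 1 ≤ C) (hC' : 1 ≤ C') (hμ : IsGauge μ Φ C)
    (hΦ : IsRegular Φ s K R) (hν : IsGauge ν Ψ C') (hΨ : IsRegular Ψ s' K' R')
    {C₁ R₁ : ℝ} (hC₁ : 1 < C₁) (hR₁ : 0 < R₁) (hcell : HasSmallCells X C₁ R₁)
    {θ r₁ α : ℝ} (hθ : 0 < θ) (hr₁ : 0 < r₁) (hα₁ : α < 1)
    (h : ∀ r r', 0 < r' → r' < θ * r → r < r₁ →
      Real.log (Φ r') - Real.log (Φ r) ≤ α * (Real.log (Ψ r') - Real.log (Ψ r))) :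
    BilipschitzEmbeds X Y := by
  have hY : Nonempty Y := by
    by_contra hcon
    rw [not_nonempty_iff] at hcon
    exact IsProbabilityMeasure.ne_zero ν (Measure.eq_zero_of_isEmpty ν)
  obtain ⟨ρ', hρ'pos, hρ'₁, hρ'R, hρ'R₁⟩ : ∃ ρ', 0 < ρ' ∧ ρ' < r₁ ∧ ρ' ≤ R' ∧ ρ' < R₁ := by
    refine ⟨min (min r₁ R') R₁ / 2, ?_⟩
    have h₁ : 0 < min (min r₁ R') R₁ := lt_min (lt_min hr₁ hΨ.R_pos) hR₁
    have h₂ := min_le_left (min r₁ R') R₁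
    have h₃ := min_le_right (min r₁ R') R₁
    have h₄ := min_le_left r₁ R'
    have h₅ := min_le_right r₁ R'
    refine ⟨by linarith, by linarith, by linarith, by linarith⟩
  set c₁ := Real.log C + K * (1 + Real.log 3) + K * (1 + Real.log (C₁ + 1)) + Real.log C' +
    K' * (1 + Real.log 5) with hc₁
  have hK := hΦ.K_pos
  have hK' := hΨ.K_pos
  have hlogC₁ : 0 ≤ Real.log (C₁ + 1) := Real.log_nonneg (by linarith)
  have hlogC : 0 ≤ Real.log C := Real.log_nonneg hC
  -- `4 ≤ N` is the contraction needed by `bilipschitzEmbeds_of_levels`, and `1 / θ < N` makes `(r,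
  -- r / N)` an admissible pair. The term `log (Φ ρ')` serves the first level, where the number of
  -- cells is not divided by a value of `Φ`.
  obtain ⟨N, hN4, hNθ, hN⟩ : ∃ N : ℕ, 4 ≤ N ∧ 1 / θ < N ∧
      c₁ + Real.log (Φ ρ') + (1 - α) * K' < (1 - α) * s' * Real.log N := by
    have h₁ := (Real.tendsto_log_atTop.comp tendsto_natCast_atTop_atTop).const_mul_atTop
      (mul_pos (sub_pos.2 hα₁) hΨ.s_pos)
    obtain ⟨N, hN⟩ := ((h₁.eventually_gt_atTop (c₁ + Real.log (Φ ρ') + (1 - α) * K')).and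
      ((eventually_ge_atTop 4).and
        (tendsto_natCast_atTop_atTop.eventually_gt_atTop (1 / θ)))).exists
    exact ⟨N, hN.2.1, hN.2.2, hN.1⟩
  have hN4' : (4 : ℝ) ≤ N := by exact_mod_cast hN4
  have hNpos : (0 : ℝ) < N := by linarith
  have hNθ' : ∀ r, 0 < r → r / N < θ * r := fun r hr => by
    rw [div_lt_iff₀ hθ] at hNθ
    rw [div_lt_iff₀ hNpos]
    nlinarith
  -- the growth of `Ψ` from one level to the next dominates all constants
  have hgap : ∀ r, 0 < r → r ≤ ρ' →
      c₁ + Real.log (Φ ρ') ≤ (1 - α) * (Real.log (Ψ (r / N)) - Real.log (Ψ r)) := by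
    intro r hr hrρ
    have h₁ := hΨ.le_log_div (a := N) (by linarith) hr (hrρ.trans hρ'R)
    have h₂ := mul_le_mul_of_nonneg_left (sub_le_sub_right h₁ (Real.log (Ψ r)))
      (sub_nonneg.2 hα₁.le)
    linarith
  have hstep : ∀ r, 0 < r → r ≤ ρ' →
      C' * (C * Φ (r / N / 3) / Φ ((C₁ + 1) * r)) * Ψ r ≤ Ψ (5 * (r / N)) := by
    intro r hr hrρ
    have hrN : 0 < r / N := by positivity
    have p₁ := hΦ.pos (r / N / 3)
    have p₂ := hΦ.pos ((C₁ + 1) * r)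
    have p₃ := hΨ.pos r
    rw [← Real.log_le_log_iff (by positivity) (hΨ.pos _),
      Real.log_mul (by positivity) p₃.ne', Real.log_mul (by positivity) (by positivity),
      Real.log_div (by positivity) p₂.ne', Real.log_mul (by positivity) p₁.ne']
    have h₁ := hΦ.log_div_le (a := 3) (by norm_num) hrN
    have h₂ := hΦ.log_le_mul (a := C₁ + 1) (by linarith) hr
    have h₃ := hΨ.log_le_mul (a := 5) (by norm_num) hrN
    have h₄ := h r (r / N) hrN (hNθ' r hr) (hrρ.trans_lt hρ'₁)
    have h₅ := hgap r hr hrρ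
    have h₆ := hΦ.log_nonneg ρ'
    linarith
  have hstart : C' * Φ (ρ' / N / 3) ≤ Ψ (5 * (ρ' / N)) := by
    have hrN : 0 < ρ' / N := by positivity
    have p₁ := hΦ.pos (ρ' / N / 3)
    rw [← Real.log_le_log_iff (by positivity) (hΨ.pos _), Real.log_mul (by positivity) p₁.ne']
    have h₁ := hΦ.log_div_le (a := 3) (by norm_num) hrN
    have h₃ := hΨ.log_le_mul (a := 5) (by norm_num) hrN
    have h₄ := h ρ' (ρ' / N) hrN (hNθ' ρ' hρ'pos) hρ'₁
    have h₅ := hgap ρ' hρ'pos le_rfl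
    have h₆ := hΨ.log_nonneg ρ'
    have h₇ : 0 ≤ K * (1 + Real.log (C₁ + 1)) := by positivity
    linarith
  -- Level `0` consists of the whole spaces at scale `D`; the geometric scales `ρ' / N ^ k` begin at
  -- level `1`. The single jump from `D` to `ρ' / N` only affects the constant.
  set D := max ρ' (max (Metric.diam (Set.univ : Set X)) (Metric.diam (Set.univ : Set Y))) with hD
  have hDρ : ρ' ≤ D := le_max_left _ _
  have hDpos : 0 < D := hρ'pos.trans_le hDρ
  have hDX : ∀ x y : X, dist x y ≤ D := fun x y =>
    (Metric.dist_le_diam_of_mem isCompact_univ.isBounded (Set.mem_univ _) (Set.mem_univ _)).trans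
      ((le_max_left _ _).trans (le_max_right _ _))
  have hDY : ∀ x y : Y, dist x y ≤ D := fun x y =>
    (Metric.dist_le_diam_of_mem isCompact_univ.isBounded (Set.mem_univ _) (Set.mem_univ _)).trans
      ((le_max_right _ _).trans (le_max_right _ _))
  let ρ : ℕ → ℝ := fun k => Nat.casesOn k D fun j => ρ' / N ^ (j + 1)
  let cl : ℕ → X → Set X := fun k => Nat.casesOn k (fun _ => Set.univ)
    fun j => cell (ρ' / N ^ (j + 1))
  have hρs : ∀ j, ρ (j + 1) = ρ' / N ^ (j + 1) := fun j => rfl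
  have hρss : ∀ j, ρ (j + 1 + 1) = ρ (j + 1) / N := fun j => by
    rw [hρs, hρs, pow_succ (N : ℝ) (j + 1), div_div]
  have hρ1 : ρ (0 + 1) = ρ' / N := by rw [hρs]; simp
  have hρpos : ∀ j, 0 < ρ j := by
    intro j
    cases j with
    | zero => exact hDpos
    | succ j => rw [hρs]; positivity
  have hρle : ∀ j, ρ (j + 1) ≤ ρ' / N := by
    intro j
    rw [hρs, pow_succ, ← div_div, div_right_comm]
    exact div_le_self (by positivity) (one_le_pow₀ (by linarith))
  have hρle' : ∀ j, ρ (j + 1) ≤ ρ' := fun j =>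
    (hρle j).trans (div_le_self hρ'pos.le (by linarith))
  have hlevel : ∀ k, ∃ M : ℕ, (∀ x, ∃ g : Set X → ℕ, Set.InjOn g (cl (k + 1) '' cl k x) ∧
      ∀ s ∈ cl (k + 1) '' cl k x, g s < M) ∧
      ∀ y : Y, ∃ t : ℕ → Y, (∀ i < M, dist (t i) y ≤ ρ k) ∧
        ∀ i < M, ∀ j < M, i ≠ j → 5 * ρ (k + 1) ≤ dist (t i) (t j) := by
    intro k
    cases k with
    | zero =>
      refine ⟨⌊Φ (ρ' / N / 3)⌋₊, fun x => exists_index _ _ _ fun T _ hT => ?_, fun y => ?_⟩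
      · refine Nat.le_floor (hμ.card_le hΦ T (by positivity) fun y hy z hz hne =>
          (lt_dist_of_notMem_cell fun hmem => hT y hy z hz hne ?_).le)
        change cell (ρ (0 + 1)) y = cell (ρ (0 + 1)) z
        rw [hρ1]
        exact (cell_eq_of_mem hmem).symm
      · refine hν.exists_separated_of_le hΨ (by linarith) y D ?_ (hΦ.pos _).le ?_
        · linarith [hρpos (0 + 1)]
        · have : Metric.closedBall y D = Set.univ :=
            Set.eq_univ_of_forall fun z => hDY z y
          rw [this, probReal_univ, mul_one, hρ1]
          exact hstart
    | succ k =>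
      refine ⟨⌊C * Φ (ρ (k + 1) / N / 3) / Φ ((C₁ + 1) * ρ (k + 1))⌋₊,
        fun x => exists_index _ _ _ fun T hT hT' => ?_, fun y => ?_⟩
      · refine Nat.le_floor (hμ.card_le_of_cells hΦ hcell (r := ρ (k + 1)) (r' := ρ (k + 1) / N)
          (div_pos (hρpos (k + 1)) hNpos) (div_le_self (hρpos (k + 1)).le (by linarith))
          ((hρle' k).trans_lt hρ'R₁) (by linarith) x T hT ?_)
        rw [← hρss]
        exact hT'
      · have hp := hΦ.pos ((C₁ + 1) * ρ (k + 1))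
        have hp' := hΦ.pos (ρ (k + 1) / N / 3)
        refine hν.exists_separated_of_le hΨ (by linarith) y _ ?_ (by positivity) ?_
        · linarith [hρpos (k + 1 + 1)]
        · have h₁ := hstep (ρ (k + 1)) (hρpos (k + 1)) (hρle' k)
          have h₂ := hν.lower y (ρ (k + 1)) (hρpos (k + 1))
          rw [hρss]
          set m := ν.real (Metric.closedBall y (ρ (k + 1)))
          have hm : 0 ≤ m := measureReal_nonneg
          set β := C * Φ (ρ (k + 1) / N / 3) / Φ ((C₁ + 1) * ρ (k + 1)) with hβ
          have hβ0 : 0 ≤ C' * β := by positivity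
          calc C' * β ≤ C' * β * (Ψ (ρ (k + 1)) * m) := le_mul_of_one_le_right hβ0 h₂
            _ = C' * β * Ψ (ρ (k + 1)) * m := by ring
            _ ≤ Ψ (5 * (ρ (k + 1) / N)) * m := mul_le_mul_of_nonneg_right h₁ hm
  choose M hM ht using hlevel
  refine bilipschitzEmbeds_of_levels ρ hρpos ?_ (L := max (N : ℝ) (D / (ρ' / N))) ?_
    (C := C₁) (by linarith) cl (fun _ _ => Set.mem_univ _) ?_ ?_ ?_ ?_ ?_ M hM ht
  · intro k
    cases k with
    | zero =>
      rw [hρ1]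
      change 4 * (ρ' / N) ≤ D
      refine le_trans ?_ hDρ
      rw [mul_div_assoc', div_le_iff₀ hNpos]
      nlinarith
    | succ k =>
      rw [hρss, mul_div_assoc', div_le_iff₀ hNpos]
      nlinarith [hρpos (k + 1)]
  · intro k
    cases k with
    | zero =>
      rw [hρ1, ← div_le_iff₀ (by positivity)]
      exact le_max_right _ _
    | succ k =>
      rw [hρss, ← div_le_iff₀ (div_pos (hρpos (k + 1)) hNpos), div_div_cancel₀ (hρpos (k + 1)).ne']
      exact le_max_left _ _
  · intro k x
    cases k with
    | zero => exact Set.mem_univ _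
    | succ k => exact mem_cell_self _ _
  · intro k x y hy
    cases k with
    | zero => rfl
    | succ k => exact cell_eq_of_mem hy
  · intro k x
    cases k with
    | zero => exact Set.subset_univ _
    | succ k =>
      refine cell_mono ?_ x
      change ρ (k + 1 + 1) ≤ ρ (k + 1)
      rw [hρss]
      exact div_le_self (hρpos (k + 1)).le (by linarith)
  · intro k x y hy
    cases k with
    | zero => exact (hDX x y).trans (le_mul_of_one_le_left hDpos.le hC₁.le)
    | succ k => exact hcell x _ (hρpos (k + 1)) ((hρle' k).trans_lt hρ'R₁) y hy
  · intro k x y hy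
    exact (lt_dist_of_notMem_cell (r := ρ (k + 1)) hy).le

end Embedding

/-! ### Coding by words with `2 ^ j` choices at place `j`. -/

theorem sum_mul_log_two (k : ℕ) : ∑ i ∈ Finset.range k, (i : ℝ) * Real.log 2 =
    k * (k - 1) / 2 * Real.log 2 := by
  induction k with
  | zero => simp
  | succ k ih => rw [Finset.sum_range_succ, ih]; push_cast; ring

/-- The sum is quadratic in `k`. This is why the branching grows with the stage: a bounded error at
each stage becomes negligible, which it would not be with bounded branching. -/
theorem eventually_mul_le_sum (a : ℝ) :
    ∀ᶠ k : ℕ in atTop, a * (k + 1) ≤ ∑ i ∈ Finset.range k, (i : ℝ) * Real.log 2 := by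
  have hlog2 : 0 < Real.log 2 := Real.log_pos one_lt_two
  filter_upwards [eventually_ge_atTop 1,
    tendsto_natCast_atTop_atTop.eventually_ge_atTop (4 * |a| / Real.log 2 + 1)] with k hk1 hk
  have hk1' : (1 : ℝ) ≤ k := by exact_mod_cast hk1
  rw [sum_mul_log_two]
  have h₀ : 4 * |a| / Real.log 2 ≤ k - 1 := by linarith
  rw [div_le_iff₀ hlog2] at h₀
  have h₁ : a * (k + 1) ≤ |a| * (2 * k) :=
    mul_le_mul (le_abs_self a) (by linarith) (by linarith) (abs_nonneg a)
  have h₂ := mul_le_mul_of_nonneg_left h₀ (by linarith : (0 : ℝ) ≤ k)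
  linarith

section Coding

variable {X : Type*} [MetricSpace X] [MeasurableSpace X]

/-- A family `N` of clopen sets containing the whole space, in which every member splits into two
members of comparable measure, and such that the measure of a member determines, through the
function `Φ`, its diameter and its distance to its complement. -/
structure IsSplitSystem (μ : Measure X) (Φ : ℝ → ℝ) (N : Set X → Prop) (D B : ℝ) : Prop where
  one_le : 1 ≤ D
  univ_mem : N Set.univ
  isClosed : ∀ U, N U → IsClosed U
  nonempty : ∀ U, N U → U.Nonempty
  pos : ∀ U, N U → 0 < μ.real U
  split : ∀ U, N U → ∃ U₁ U₂, N U₁ ∧ N U₂ ∧ U = U₁ ∪ U₂ ∧ Disjoint U₁ U₂ ∧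
    μ.real U ≤ D * μ.real U₁ ∧ μ.real U ≤ D * μ.real U₂
  le_log : ∀ U, N U → ∀ x ∈ U, ∀ y ∈ U, x ≠ y →
    -Real.log (μ.real U) - B ≤ Real.log (Φ (dist x y))
  log_le : ∀ U, N U → ∀ x ∈ U, ∀ y ∉ U, Real.log (Φ (dist x y)) ≤ -Real.log (μ.real U) + B

variable {μ : Measure X} [IsProbabilityMeasure μ] {Φ : ℝ → ℝ} {N : Set X → Prop} {D B : ℝ}

/-- The heaviest piece is always the one to be split. All masses then stay in an interval `[M / D,
M]`, the new `M` being the mass of the piece just split. -/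
theorem IsSplitSystem.exists_partition_aux (h : IsSplitSystem μ Φ N D B) {U : Set X} (hU : N U)
    (k : ℕ) : ∃ P : ℕ → Set X, (∀ i < k + 1, N (P i)) ∧ (∀ x, x ∈ U ↔ ∃ i < k + 1, x ∈ P i) ∧
      (∀ i < k + 1, ∀ j < k + 1, i ≠ j → Disjoint (P i) (P j)) ∧
      ∃ M, ∀ i < k + 1, M ≤ D * μ.real (P i) ∧ μ.real (P i) ≤ M := by
  have hD := h.one_le
  induction k with
  | zero =>
    refine ⟨fun _ => U, fun _ _ => hU, fun x => ⟨fun hx => ⟨0, by simp, hx⟩, fun ⟨_, _, hx⟩ => hx⟩,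
      fun i hi j hj hij => absurd (by omega) hij, μ.real U, fun i _ => ⟨?_, le_rfl⟩⟩
    exact le_mul_of_one_le_left measureReal_nonneg hD
  | succ k ih =>
    obtain ⟨P, hPN, hPU, hPd, M, hM⟩ := ih
    obtain ⟨i, hi, hmax⟩ := Finset.exists_max_image (Finset.range (k + 1)) (fun i => μ.real (P i))
      ⟨0, by simp⟩
    rw [Finset.mem_range] at hi
    obtain ⟨U₁, U₂, hN₁, hN₂, hU₁₂, hdisj, h₁, h₂⟩ := h.split _ (hPN i hi)
    have hs₁ : U₁ ⊆ P i := hU₁₂ ▸ Set.subset_union_left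
    have hs₂ : U₂ ⊆ P i := hU₁₂ ▸ Set.subset_union_right
    set P' : ℕ → Set X := fun j => if j = i then U₁ else if j = k + 1 then U₂ else P j with hP'
    have e₁ : P' i = U₁ := by simp [hP']
    have e₂ : P' (k + 1) = U₂ := by
      simp only [hP', if_neg (by omega : k + 1 ≠ i), if_true]
    have e₃ : ∀ j < k + 1, j ≠ i → P' j = P j := fun j hj hji => by
      simp only [hP', if_neg hji, if_neg (by omega : j ≠ k + 1)]
    have hcases : ∀ j < k + 1 + 1, j = i ∨ j = k + 1 ∨ (j < k + 1 ∧ j ≠ i) := fun j hj => by omega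
    refine ⟨P', ?_, ?_, ?_, μ.real (P i), ?_⟩
    · intro j hj
      rcases hcases j hj with rfl | rfl | ⟨hj', hji⟩
      · rwa [e₁]
      · rwa [e₂]
      · rw [e₃ j hj' hji]; exact hPN j hj'
    · intro x
      rw [hPU]
      constructor
      · rintro ⟨j, hj, hx⟩
        by_cases hji : j = i
        · subst hji
          rw [hU₁₂] at hx
          rcases hx with hx | hx
          · exact ⟨j, by omega, by rwa [e₁]⟩
          · exact ⟨k + 1, by omega, by rwa [e₂]⟩
        · exact ⟨j, by omega, by rwa [e₃ j hj hji]⟩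
      · rintro ⟨j, hj, hx⟩
        rcases hcases j hj with rfl | rfl | ⟨hj', hji⟩
        · rw [e₁] at hx
          exact ⟨j, hi, hs₁ hx⟩
        · rw [e₂] at hx
          exact ⟨i, hi, hs₂ hx⟩
        · rw [e₃ j hj' hji] at hx
          exact ⟨j, hj', hx⟩
    · intro a ha b hb hab
      rcases hcases a ha with rfl | rfl | ⟨ha', hai⟩ <;>
        rcases hcases b hb with rfl | rfl | ⟨hb', hbi⟩
      · exact absurd rfl hab
      · rwa [e₁, e₂]
      · rw [e₁, e₃ b hb' hbi]
        exact (hPd a hi b hb' hab).mono_left hs₁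
      · rw [e₁, e₂]
        exact hdisj.symm
      · exact absurd rfl hab
      · rw [e₂, e₃ b hb' hbi]
        exact (hPd i hi b hb' (Ne.symm hbi)).mono_left hs₂
      · rw [e₁, e₃ a ha' hai]
        exact (hPd a ha' b hi hab).mono_right hs₁
      · rw [e₂, e₃ a ha' hai]
        exact (hPd a ha' i hi hai).mono_right hs₂
      · rw [e₃ a ha' hai, e₃ b hb' hbi]
        exact hPd a ha' b hb' hab
    · intro j hj
      rcases hcases j hj with rfl | rfl | ⟨hj', hji⟩
      · rw [e₁]
        exact ⟨h₁, measureReal_mono hs₁ (measure_ne_top _ _)⟩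
      · rw [e₂]
        exact ⟨h₂, measureReal_mono hs₂ (measure_ne_top _ _)⟩
      · rw [e₃ j hj' hji]
        exact ⟨(hM i hi).2.trans (hM j hj').1, hmax j (Finset.mem_range.2 hj')⟩

variable [BorelSpace X]

theorem IsSplitSystem.exists_partition (h : IsSplitSystem μ Φ N D B) {U : Set X} (hU : N U)
    {k : ℕ} (hk : 0 < k) :
    ∃ P : ℕ → Set X, (∀ i < k, N (P i)) ∧ (∀ x, x ∈ U ↔ ∃ i < k, x ∈ P i) ∧
      (∀ i < k, ∀ j < k, i ≠ j → Disjoint (P i) (P j)) ∧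
      ∀ i < k, |Real.log (μ.real (P i)) - (Real.log (μ.real U) - Real.log k)| ≤ Real.log D := by
  obtain ⟨l, rfl⟩ : ∃ l, k = l + 1 := ⟨k - 1, by omega⟩
  obtain ⟨P, hPN, hPU, hPd, M, hM⟩ := h.exists_partition_aux hU l
  refine ⟨P, hPN, hPU, hPd, fun i hi => ?_⟩
  have hsum : μ.real U = ∑ j ∈ Finset.range (l + 1), μ.real (P j) := by
    rw [← measureReal_biUnion_finset]
    · congr 1
      ext x
      simp [hPU]
    · intro a ha b hb hab
      exact hPd a (by simpa using ha) b (by simpa using hb) hab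
    · intro j hj
      exact (h.isClosed _ (hPN j (Finset.mem_range.1 hj))).measurableSet
  have hPpos := h.pos _ (hPN i hi)
  have hUpos := h.pos _ hU
  have hDpos : 0 < D := one_pos.trans_le h.one_le
  have h₁ : μ.real U ≤ (l + 1 : ℕ) * (D * μ.real (P i)) := by
    rw [hsum, ← nsmul_eq_mul]
    refine (Finset.sum_le_card_nsmul _ _ (D * μ.real (P i)) fun j hj => ?_).trans_eq (by simp)
    exact (hM j (Finset.mem_range.1 hj)).2.trans (hM i hi).1
  have h₂ : (l + 1 : ℕ) * μ.real (P i) ≤ D * μ.real U := by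
    rw [hsum, Finset.mul_sum, ← nsmul_eq_mul]
    have h₃ := Finset.card_nsmul_le_sum (Finset.range (l + 1)) (fun j => D * μ.real (P j))
      (μ.real (P i)) fun j hj => (hM i hi).2.trans (hM j (Finset.mem_range.1 hj)).1
    rwa [Finset.card_range] at h₃
  have hl : (0 : ℝ) < (l + 1 : ℕ) := by positivity
  have h₃ := Real.log_le_log hUpos h₁
  have h₄ := Real.log_le_log (by positivity) h₂
  rw [Real.log_mul hl.ne' (by positivity), Real.log_mul hDpos.ne' hPpos.ne'] at h₃
  rw [Real.log_mul hl.ne' hPpos.ne', Real.log_mul hDpos.ne' hUpos.ne'] at h₄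
  rw [abs_le]
  constructor <;> linarith

/-- Stage `j` cuts a member into `2 ^ j` members of nearly equal mass, with error `log D` in the
logarithm, so `-log` of the mass after `j` stages is the quadratic sum up to `O(j)`. The masses tend
to `0`, so `le_log` makes codes injective; compactness makes every code occur. -/
theorem IsSplitSystem.exists_coding [CompactSpace X] (h : IsSplitSystem μ Φ N D B) :
    ∃ (e : X ≃ ∀ j, Fin (2 ^ j)) (L : ℝ), 0 < L ∧ ∀ x y j, (∀ i < j, e x i = e y i) →
      e x j ≠ e y j →
      |Real.log (Φ (dist x y)) - ∑ i ∈ Finset.range j, (i : ℝ) * Real.log 2| ≤ L * (j + 1) := by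
  classical
  have hex : ∀ (U : Set X) (k : ℕ), ∃ P : ℕ → Set X, N U → 0 < k →
      (∀ i < k, N (P i)) ∧ (∀ x, x ∈ U ↔ ∃ i < k, x ∈ P i) ∧
      (∀ i < k, ∀ j < k, i ≠ j → Disjoint (P i) (P j)) ∧
      ∀ i < k, |Real.log (μ.real (P i)) - (Real.log (μ.real U) - Real.log k)| ≤ Real.log D := by
    intro U k
    by_cases hU : N U ∧ 0 < k
    · obtain ⟨P, hP⟩ := h.exists_partition hU.1 hU.2
      exact ⟨P, fun _ _ => hP⟩
    · exact ⟨fun _ => ∅, fun h₁ h₂ => absurd ⟨h₁, h₂⟩ hU⟩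
  choose P hP using hex
  have h2 : ∀ k, 0 < 2 ^ k := fun k => by positivity
  let U : ℕ → (∀ j, Fin (2 ^ j)) → Set X := fun k ω =>
    Nat.rec Set.univ (fun k V => P V (2 ^ k) (ω k)) k
  have hU0 : ∀ ω, U 0 ω = Set.univ := fun ω => rfl
  have hUs : ∀ k ω, U (k + 1) ω = P (U k ω) (2 ^ k) (ω k) := fun k ω => rfl
  have hUN : ∀ k ω, N (U k ω) := by
    intro k ω
    induction k with
    | zero => exact h.univ_mem
    | succ k ih => exact (hP _ _ ih (h2 k)).1 _ (ω k).2
  have hUsub : ∀ k ω, U (k + 1) ω ⊆ U k ω := fun k ω x hx =>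
    ((hP _ _ (hUN k ω) (h2 k)).2.1 x).2 ⟨ω k, (ω k).2, hx⟩
  have hUcongr : ∀ k ω ω', (∀ i < k, ω i = ω' i) → U k ω = U k ω' := by
    intro k ω ω'
    induction k with
    | zero => intro _; rfl
    | succ k ih =>
      intro hi
      rw [hUs, hUs, ih fun i hik => hi i (by omega), hi k (by omega)]
  have hlog : ∀ k ω, |Real.log (μ.real (U k ω)) + ∑ i ∈ Finset.range k, (i : ℝ) * Real.log 2| ≤
      k * Real.log D := by
    intro k ω
    induction k with
    | zero => simp [hU0]
    | succ k ih =>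
      have h₁ := (hP _ _ (hUN k ω) (h2 k)).2.2.2 _ (ω k).2
      rw [← hUs, Nat.cast_pow, Nat.cast_two, Real.log_pow] at h₁
      rw [Finset.sum_range_succ]
      rw [abs_le] at ih h₁ ⊢
      push_cast
      constructor <;> linarith
  -- two points whose codes agree up to `j` but not at `j` are separated at that stage
  have hsepU : ∀ j ω ω' x, (∀ i < j, ω i = ω' i) → x ∈ U (j + 1) ω → x ∈ U (j + 1) ω' →
      ω j = ω' j := by
    intro j ω ω' x hi hx hx'
    by_contra hne
    rw [hUs] at hx hx'
    rw [← hUcongr j ω ω' hi] at hx'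
    exact Set.disjoint_left.1 ((hP _ _ (hUN j ω) (h2 j)).2.2.1 _ (ω j).2 _ (ω' j).2
      fun he => hne (Fin.ext he)) hx hx'
  have huniq : ∀ ω ω' x, (∀ k, x ∈ U k ω) → (∀ k, x ∈ U k ω') → ω = ω' := by
    intro ω ω' x hx hx'
    funext j
    induction j using Nat.strong_induction_on with
    | _ j ih => exact hsepU j ω ω' x ih (hx (j + 1)) (hx' (j + 1))
  have hcode : ∀ x, ∃ ω, ∀ k, x ∈ U k ω := by
    intro x
    have hpick : ∀ (V : Set X) (k : ℕ), ∃ i : Fin (2 ^ k), N V → x ∈ V → x ∈ P V (2 ^ k) i := by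
      intro V k
      by_cases hV : N V ∧ x ∈ V
      · obtain ⟨i, hi, hx⟩ := ((hP V (2 ^ k) hV.1 (h2 k)).2.1 x).1 hV.2
        exact ⟨⟨i, hi⟩, fun _ _ => hx⟩
      · exact ⟨⟨0, h2 k⟩, fun h₁ h₂ => absurd ⟨h₁, h₂⟩ hV⟩
    choose pick hpick using hpick
    let V : ℕ → Set X := fun k => Nat.rec Set.univ (fun k V => P V (2 ^ k) (pick V k)) k
    have hVU : ∀ k, V k = U k fun k => pick (V k) k := by
      intro k
      induction k with
      | zero => rfl
      | succ k ih =>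
        change P (V k) (2 ^ k) (pick (V k) k) = _
        rw [hUs, ← ih]
    refine ⟨fun k => pick (V k) k, fun k => ?_⟩
    induction k with
    | zero => exact Set.mem_univ _
    | succ k ih =>
      rw [hUs, ← hVU]
      rw [← hVU] at ih
      exact hpick _ _ (by rw [hVU]; exact hUN _ _) ih
  choose f hf using hcode
  have hlogD : 0 ≤ Real.log D := Real.log_nonneg h.one_le
  have hQ : ∀ a b : ℝ, ∃ k : ℕ, a + k * b < ∑ i ∈ Finset.range k, (i : ℝ) * Real.log 2 := by
    intro a b
    obtain ⟨k, hk⟩ := (eventually_mul_le_sum (|a| + |b| + 1)).exists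
    refine ⟨k, lt_of_lt_of_le ?_ hk⟩
    have h₁ := mul_nonneg (Nat.cast_nonneg (α := ℝ) k) (abs_nonneg a)
    have h₂ := mul_le_mul_of_nonneg_left (le_abs_self b) (Nat.cast_nonneg (α := ℝ) k)
    linarith [le_abs_self a, abs_nonneg b, Nat.cast_nonneg (α := ℝ) k]
  have hinj : Function.Injective f := by
    intro x y hxy
    by_contra hne
    obtain ⟨k, hk⟩ := hQ (Real.log (Φ (dist x y)) + B) (Real.log D)
    have h₁ := h.le_log _ (hUN k (f x)) x (hf x k) y (hxy ▸ hf y k) hne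
    have h₂ := (abs_le.1 (hlog k (f x))).2
    linarith
  have hsurj : Function.Surjective f := by
    intro ω
    obtain ⟨x, hx⟩ := IsCompact.nonempty_iInter_of_sequence_nonempty_isCompact_isClosed
      (fun k => U k ω) (fun k => hUsub k ω) (fun k => h.nonempty _ (hUN k ω))
      isCompact_univ (fun k => h.isClosed _ (hUN k ω))
    exact ⟨x, huniq _ _ x (hf x) (Set.mem_iInter.1 hx)⟩
  refine ⟨Equiv.ofBijective f ⟨hinj, hsurj⟩, Real.log D + |B| + Real.log 2, ?_, ?_⟩
  · have : 0 < Real.log 2 := Real.log_pos one_lt_two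
    positivity
  · intro x y j hij hj
    change ∀ i < j, f x i = f y i at hij
    change f x j ≠ f y j at hj
    have hne : x ≠ y := fun he => hj (by rw [he])
    -- Lying in a common member after `j` stages bounds `log Φ` of the distance below, and lying in
    -- different members after `j + 1` stages bounds it above. The two bounds differ by `j * log 2 +
    -- O(j)`, absorbed by `L`.
    have h₁ := h.le_log _ (hUN j (f x)) x (hf x j) y
      (by rw [hUcongr j _ _ hij]; exact hf y j) hne
    have h₂ := h.log_le _ (hUN (j + 1) (f x)) x (hf x (j + 1)) y
      fun hmem => hj (hsepU j _ _ y hij hmem (hf y (j + 1)))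
    have h₃ := abs_le.1 (hlog j (f x))
    have h₄ := abs_le.1 (hlog (j + 1) (f x))
    rw [Finset.sum_range_succ] at h₄
    push_cast at h₄
    have hB := le_abs_self B
    have hjB : 0 ≤ (j : ℝ) * |B| := by positivity
    have hlog2 : 0 < Real.log 2 := Real.log_pos one_lt_two
    have hj2 : 0 ≤ (j : ℝ) * Real.log 2 := by positivity
    rw [abs_le]
    constructor <;> nlinarith

end Coding

/-! ### Split systems from cells. -/

section SplitSystem

variable {X : Type*} [MetricSpace X] [MeasurableSpace X] {μ : Measure X}
  [IsProbabilityMeasure μ] {Φ : ℝ → ℝ} {C s K R : ℝ}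

/-- A node of level `k` is a union of at least two cells of level `k + 1` inside one cell of level
`k`, so its mass is comparable to `1 / Φ (ρ k)`. It is split by detaching one cell of level `k + 1`,
itself a node one level down. -/
theorem IsGauge.exists_isSplitSystem (hC : 1 ≤ C) (hμ : IsGauge μ Φ C) (hΦ : IsRegular Φ s K R)
    {C₁ R₁ : ℝ} (hC₁ : 1 < C₁) (hR₁ : 0 < R₁) (hcell : HasSmallCells X C₁ R₁) :
    ∃ (N : Set X → Prop) (D B : ℝ), IsSplitSystem μ Φ N D B := by
  have hX : Nonempty X := by
    by_contra hcon
    rw [not_nonempty_iff] at hcon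
    exact IsProbabilityMeasure.ne_zero μ (Measure.eq_zero_of_isEmpty μ)
  obtain ⟨r₀, hr₀, hr₀R, hr₀R₁⟩ : ∃ r₀, 0 < r₀ ∧ r₀ ≤ R ∧ r₀ < R₁ := by
    refine ⟨min R (R₁ / 2), lt_min hΦ.R_pos (by linarith), min_le_left _ _, ?_⟩
    exact (min_le_right _ _).trans_lt (by linarith)
  have hK := hΦ.K_pos
  have hlogC : 0 ≤ Real.log C := Real.log_nonneg hC
  have hlogC₁ : 0 ≤ Real.log C₁ := Real.log_nonneg hC₁.le
  -- The ratio `q` is so large that a cell of level `k + 1` has less mass than any cell of level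
  -- `k`; hence every cell properly contains its subcells.
  obtain ⟨q, hq₁, hqC₁, hq⟩ : ∃ q : ℕ, 1 ≤ q ∧ C₁ ≤ q ∧
      Real.log C + K + s * Real.log C₁ < s * Real.log q := by
    have h₁ := (Real.tendsto_log_atTop.comp tendsto_natCast_atTop_atTop).const_mul_atTop hΦ.s_pos
    obtain ⟨q, hq⟩ := ((h₁.eventually_gt_atTop (Real.log C + K + s * Real.log C₁)).and
      ((eventually_ge_atTop 1).and
        (tendsto_natCast_atTop_atTop.eventually_ge_atTop C₁))).exists
    exact ⟨q, hq.2.1, hq.2.2, hq.1⟩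
  have hq₁' : (1 : ℝ) ≤ q := by exact_mod_cast hq₁
  have hqpos : (0 : ℝ) < q := by linarith
  have hlogq : 0 ≤ Real.log q := Real.log_nonneg hq₁'
  let ρ : ℕ → ℝ := fun k => r₀ / q ^ k
  let cl : ℕ → X → Set X := fun k => Nat.casesOn k (fun _ => Set.univ)
    fun j => cell (r₀ / q ^ (j + 1))
  have hcls : ∀ j x, cl (j + 1) x = cell (ρ (j + 1)) x := fun j x => rfl
  have hρ0 : ρ 0 = r₀ := by simp [ρ]
  have hρs : ∀ j, ρ (j + 1) = ρ j / q := fun j => by simp only [ρ, pow_succ, div_div]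
  have hρpos : ∀ j, 0 < ρ j := fun j => by positivity
  have hρle : ∀ j, ρ j ≤ r₀ := fun j => div_le_self hr₀.le (one_le_pow₀ hq₁')
  have hρanti : ∀ j, ρ (j + 1) ≤ ρ j := fun j => by
    rw [hρs]; exact div_le_self (hρpos j).le hq₁'
  have hbig : ∀ k, C * Φ (ρ k) < Φ (C₁ * ρ (k + 1)) := by
    intro k
    have p₁ := hΦ.pos (ρ k)
    rw [← Real.log_lt_log_iff (by positivity) (hΦ.pos _), Real.log_mul (by positivity) p₁.ne']
    have h₁ := hΦ.le_log_div (a := q / C₁) ((one_le_div (by linarith)).2 hqC₁) (hρpos k)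
      ((hρle k).trans hr₀R)
    rw [Real.log_div (by positivity) (by positivity), div_div_eq_mul_div, mul_comm (ρ k),
      ← mul_div_assoc', ← hρs] at h₁
    linarith
  have hself : ∀ k x, x ∈ cl k x := by
    intro k x
    cases k with
    | zero => exact Set.mem_univ _
    | succ k => exact mem_cell_self _ _
  have heq : ∀ k x y, y ∈ cl k x → cl k y = cl k x := by
    intro k x y hy
    cases k with
    | zero => rfl
    | succ k => exact cell_eq_of_mem hy
  have hsub : ∀ k x, cl (k + 1) x ⊆ cl k x := by
    intro k x
    cases k with
    | zero => exact Set.subset_univ _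
    | succ k => exact cell_mono (hρanti (k + 1)) x
  have hlow : ∀ k x, 1 ≤ Φ (ρ k) * μ.real (cl k x) := by
    intro k x
    cases k with
    | zero =>
      change 1 ≤ Φ (ρ 0) * μ.real Set.univ
      rw [probReal_univ, mul_one]
      exact hΦ.one_le _
    | succ k =>
      refine (hμ.lower x (ρ (k + 1)) (hρpos (k + 1))).trans
        (mul_le_mul_of_nonneg_left ?_ (hΦ.pos _).le)
      exact measureReal_mono (closedBall_subset_cell _ _) (measure_ne_top _ _)
  have hdist : ∀ k x y, y ∈ cl (k + 1) x → dist x y ≤ C₁ * ρ (k + 1) := fun k x y hy =>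
    hcell x _ (hρpos (k + 1)) ((hρle (k + 1)).trans_lt hr₀R₁) y hy
  have hup : ∀ k x, Φ (C₁ * ρ (k + 1)) * μ.real (cl (k + 1) x) ≤ C := by
    intro k x
    refine le_trans (mul_le_mul_of_nonneg_left ?_ (hΦ.pos _).le)
      (hμ.upper x (C₁ * ρ (k + 1)) (mul_pos (by linarith) (hρpos (k + 1))))
    refine measureReal_mono (fun y hy => ?_) (measure_ne_top _ _)
    rw [Metric.mem_closedBall, dist_comm]
    exact hdist k x y hy
  have hproper : ∀ k x, ∃ y ∈ cl k x, y ∉ cl (k + 1) x := by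
    intro k x
    by_contra! hcon
    have h₁ : μ.real (cl k x) ≤ μ.real (cl (k + 1) x) :=
      measureReal_mono hcon (measure_ne_top _ _)
    have h₂ := hlow k x
    have hm : 0 < μ.real (cl k x) := pos_of_mul_pos_right (one_pos.trans_le h₂) (hΦ.pos _).le
    have h₃ := mul_lt_mul_of_pos_right (hbig k) hm
    have h₄ := mul_le_mul_of_nonneg_left h₁ (hΦ.pos (C₁ * ρ (k + 1))).le
    have h₅ := mul_le_mul_of_nonneg_left h₂ (by linarith : 0 ≤ C)
    linarith [hup k x]
  let IsNode : ℕ → Set X → Prop := fun k U => (∃ x, U ⊆ cl k x) ∧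
    (∀ y ∈ U, cl (k + 1) y ⊆ U) ∧ ∃ y ∈ U, ∃ z ∈ U, z ∉ cl (k + 1) y
  have hcellnode : ∀ k x, IsNode k (cl k x) := by
    intro k x
    refine ⟨⟨x, le_rfl⟩, fun y hy => heq k x y hy ▸ hsub k y, x, hself k x, hproper k x⟩
  set a := K * (1 + Real.log q) with ha
  set b := Real.log C + K * (1 + Real.log C₁) + Real.log (Φ r₀) with hb
  have ha0 : 0 ≤ a := by positivity
  have hb1 : 0 ≤ K * (1 + Real.log C₁) := by positivity
  have hb2 := hΦ.log_nonneg r₀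
  have hb0 : 0 ≤ b := by linarith
  have hΦs : ∀ k, Real.log (Φ (ρ (k + 1))) ≤ Real.log (Φ (ρ k)) + a := fun k => by
    rw [hρs]
    exact hΦ.log_div_le hq₁' (hρpos k)
  have hmpos : ∀ k U, IsNode k U → 0 < μ.real U := by
    rintro k U ⟨-, hsat, y, hy, -⟩
    have h₁ : μ.real (cl (k + 1) y) ≤ μ.real U :=
      measureReal_mono (hsat y hy) (measure_ne_top _ _)
    exact (pos_of_mul_pos_right (one_pos.trans_le (hlow (k + 1) y)) (hΦ.pos _).le).trans_le h₁
  have hmlow : ∀ k U, IsNode k U → -Real.log (μ.real U) ≤ Real.log (Φ (ρ (k + 1))) := by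
    intro k U hU
    have hpos := hmpos k U hU
    obtain ⟨-, hsat, y, hy, -⟩ := hU
    have h₁ : μ.real (cl (k + 1) y) ≤ μ.real U :=
      measureReal_mono (hsat y hy) (measure_ne_top _ _)
    have h₂ := (hlow (k + 1) y).trans (mul_le_mul_of_nonneg_left h₁ (hΦ.pos _).le)
    have h₃ := Real.log_nonneg h₂
    rw [Real.log_mul (hΦ.pos _).ne' hpos.ne'] at h₃
    linarith
  have hmup : ∀ k U, IsNode k U → Real.log (Φ (ρ k)) - b ≤ -Real.log (μ.real U) := by
    intro k U hU
    have hpos := hmpos k U hU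
    obtain ⟨⟨x, hx⟩, -, -⟩ := hU
    cases k with
    | zero =>
      rw [hρ0]
      have := Real.log_nonpos hpos.le (measureReal_le_one (μ := μ) (s := U))
      linarith
    | succ k =>
      have h₁ : μ.real U ≤ μ.real (cl (k + 1) x) := measureReal_mono hx (measure_ne_top _ _)
      have h₂ := (mul_le_mul_of_nonneg_left h₁ (hΦ.pos (C₁ * ρ (k + 1))).le).trans (hup k x)
      have p₁ := hΦ.pos (C₁ * ρ (k + 1))
      have h₃ := Real.log_le_log (by positivity) h₂
      rw [Real.log_mul p₁.ne' hpos.ne'] at h₃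
      have h₄ := hΦ.log_le_mul hC₁.le (hρpos (k + 1))
      linarith
  refine ⟨fun U => ∃ k, IsNode k U, Real.exp (a + a + b), a + b, ?_⟩
  refine ⟨Real.one_le_exp (by linarith), ⟨0, hcellnode 0 (Classical.arbitrary X)⟩, ?_, ?_, ?_, ?_,
    ?_, ?_⟩
  · rintro U ⟨k, -, hsat, -⟩
    exact isClosed_of_cell_subset (hρpos (k + 1)) hsat
  · rintro U ⟨k, -, -, y, hy, -⟩
    exact ⟨y, hy⟩
  · rintro U ⟨k, hU⟩
    exact hmpos k U hU
  · rintro U ⟨k, hU⟩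
    have hU' := hU
    obtain ⟨⟨x, hx⟩, hsat, y, hy, z, hz, hzy⟩ := hU'
    have hdrop : ∀ V, (IsNode k V ∨ IsNode (k + 1) V) →
        μ.real U ≤ Real.exp (a + a + b) * μ.real V := by
      intro V hV
      have hVpos : 0 < μ.real V := by
        rcases hV with hV | hV
        · exact hmpos k V hV
        · exact hmpos (k + 1) V hV
      have h₁ : -Real.log (μ.real V) ≤ Real.log (Φ (ρ k)) + a + a := by
        rcases hV with hV | hV
        · linarith [hmlow k V hV, hΦs k]
        · linarith [hmlow (k + 1) V hV, hΦs k, hΦs (k + 1)]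
      rw [← Real.log_le_log_iff (hmpos k U hU) (by positivity),
        Real.log_mul (Real.exp_pos _).ne' hVpos.ne', Real.log_exp]
      linarith [hmup k U hU]
    have hU₁ : IsNode (k + 1) (cl (k + 1) y) := hcellnode (k + 1) y
    have hsat₂ : ∀ w ∈ U \ cl (k + 1) y, cl (k + 1) w ⊆ U \ cl (k + 1) y := by
      intro w hw v hv
      refine ⟨hsat w hw.1 hv, fun hvy => hw.2 ?_⟩
      rw [← heq (k + 1) y v hvy, heq (k + 1) w v hv]
      exact hself (k + 1) w
    -- What remains is still a node of level `k` unless it is a single cell, in which case it is a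
    -- node of level `k + 1`.
    have hU₂ : IsNode k (U \ cl (k + 1) y) ∨ IsNode (k + 1) (U \ cl (k + 1) y) := by
      by_cases h : ∃ v ∈ U \ cl (k + 1) y, ∃ w ∈ U \ cl (k + 1) y, w ∉ cl (k + 1) v
      · exact Or.inl ⟨⟨x, Set.sdiff_subset.trans hx⟩, hsat₂, h⟩
      · right
        push Not at h
        have : U \ cl (k + 1) y = cl (k + 1) z :=
          Set.Subset.antisymm (h z ⟨hz, hzy⟩) (hsat₂ z ⟨hz, hzy⟩)
        rw [this]
        exact hcellnode (k + 1) z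
    refine ⟨cl (k + 1) y, U \ cl (k + 1) y, ⟨k + 1, hU₁⟩, ?_, ?_, Set.disjoint_sdiff_right,
      hdrop _ (Or.inr hU₁), hdrop _ hU₂⟩
    · rcases hU₂ with h | h
      · exact ⟨k, h⟩
      · exact ⟨k + 1, h⟩
    · exact (Set.union_sdiff_cancel (hsat y hy)).symm
  · rintro U ⟨k, hU⟩ x hx y hy hne
    have h₁ := hmlow k U hU
    have h₂ := hΦs k
    have h₃ : Real.log (Φ (ρ k)) - b ≤ Real.log (Φ (dist x y)) := by
      obtain ⟨⟨z, hz⟩, -, -⟩ := hU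
      cases k with
      | zero =>
        rw [hρ0]
        linarith [hΦ.log_nonneg (dist x y)]
      | succ k =>
        have hd := hdist k x y (heq (k + 1) z x (hz hx) ▸ hz hy)
        have h₄ := Real.log_le_log (hΦ.pos _) (hΦ.anti _ _ (dist_pos.2 hne) hd)
        linarith [hΦ.log_le_mul hC₁.le (hρpos (k + 1))]
    linarith
  · rintro U ⟨k, hU⟩ x hx y hy
    have h₁ := hmup k U hU
    have h₂ := hΦs k
    have hd : ρ (k + 1) ≤ dist x y :=
      (lt_dist_of_notMem_cell (r := ρ (k + 1)) fun h => hy (hU.2.1 x hx h)).le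
    have h₃ := Real.log_le_log (hΦ.pos _) (hΦ.anti _ _ (hρpos (k + 1)) hd)
    linarith

end SplitSystem

/-! ### Logarithmic asymptotics at small scales. -/

section Asymptotics

variable {Φ Ψ : ℝ → ℝ} {s K R s' K' R' : ℝ}

theorem tendsto_neg_log_nhdsGT_zero : Tendsto (fun r => -Real.log r) (𝓝[>] 0) atTop :=
  tendsto_neg_atBot_atTop.comp Real.tendsto_log_nhdsGT_zero

theorem eventually_le_nhdsGT_zero {a : ℝ} (ha : 0 < a) : ∀ᶠ r in 𝓝[>] (0 : ℝ), r ≤ a :=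
  (eventually_le_nhds ha).filter_mono nhdsWithin_le_nhds

theorem IsRegular.eventually_le_log (hΦ : IsRegular Φ s K R) :
    ∀ᶠ r in 𝓝[>] (0 : ℝ), s / 2 * -Real.log r ≤ Real.log (Φ r) := by
  have hs := hΦ.s_pos
  filter_upwards [eventually_le_nhdsGT_zero hΦ.R_pos, self_mem_nhdsWithin,
    (tendsto_neg_log_nhdsGT_zero.const_mul_atTop (half_pos hs)).eventually_ge_atTop
      (K - s * Real.log R)] with r hrR hr hlog
  have h := hΦ.lower r R hr hrR le_rfl
  rw [Real.log_div hΦ.R_pos.ne' (ne_of_gt hr)] at h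
  linarith [hΦ.log_nonneg R]

theorem IsRegular.tendsto_log (hΦ : IsRegular Φ s K R) :
    Tendsto (fun r => Real.log (Φ r)) (𝓝[>] 0) atTop :=
  tendsto_atTop_mono' _ hΦ.eventually_le_log
    (tendsto_neg_log_nhdsGT_zero.const_mul_atTop (half_pos hΦ.s_pos))

theorem IsRegular.eventually_log_le (hΦ : IsRegular Φ s K R) :
    ∀ᶠ r in 𝓝[>] (0 : ℝ), Real.log (Φ r) ≤ 2 * K * -Real.log r := by
  have hK := hΦ.K_pos
  filter_upwards [eventually_le_nhdsGT_zero one_pos, self_mem_nhdsWithin,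
    (tendsto_neg_log_nhdsGT_zero.const_mul_atTop hK).eventually_ge_atTop
      (Real.log (Φ 1) + K)] with r hr1 hr hlog
  have h := hΦ.upper r 1 hr hr1
  rw [one_div, Real.log_inv] at h
  linarith

/-- A large `A` forces a large `j`, and then the linear errors are a small fraction of the quadratic
sum. -/
theorem exists_forall_abs_sub_le {η L L' : ℝ} (hη : 0 < η) (hL : 0 < L) :
    ∃ A₀ : ℝ, ∀ A B : ℝ, ∀ j : ℕ, A₀ < A →
      |A - ∑ i ∈ Finset.range j, (i : ℝ) * Real.log 2| ≤ L * (j + 1) →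
      |B - ∑ i ∈ Finset.range j, (i : ℝ) * Real.log 2| ≤ L' * (j + 1) → |A - B| ≤ η * A := by
  obtain ⟨j₀, hj₀⟩ := eventually_atTop.1 ((eventually_mul_le_sum (2 * L)).and
    (eventually_mul_le_sum (2 * (L + L') / η)))
  have hlog2 : 0 < Real.log 2 := Real.log_pos one_lt_two
  refine ⟨∑ i ∈ Finset.range j₀, (i : ℝ) * Real.log 2 + L * (j₀ + 1), ?_⟩
  intro A B j hA h₁ h₂
  rw [abs_le] at h₁ h₂
  have hj : j₀ ≤ j := by
    by_contra hlt
    have h₃ : ∑ i ∈ Finset.range j, (i : ℝ) * Real.log 2 ≤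
        ∑ i ∈ Finset.range j₀, (i : ℝ) * Real.log 2 :=
      Finset.sum_le_sum_of_subset_of_nonneg (by simpa using (not_le.1 hlt).le)
        fun i _ _ => by positivity
    have h₄ : (j : ℝ) ≤ j₀ := by exact_mod_cast (not_le.1 hlt).le
    have h₅ := mul_le_mul_of_nonneg_left h₄ hL.le
    linarith
  obtain ⟨h₃, h₄⟩ := hj₀ j hj
  rw [div_mul_eq_mul_div, div_le_iff₀ hη] at h₄
  set Q := ∑ i ∈ Finset.range j, (i : ℝ) * Real.log 2
  have h₅ : Q ≤ 2 * A := by linarith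
  have h₆ := mul_le_mul_of_nonneg_left h₅ hη.le
  rw [abs_le]
  constructor <;> linarith

theorem IsRegular.mul_abs_log_sub_le (hΦ : IsRegular Φ s K R) {a b : ℝ} (ha : 0 < a) (hb : 0 < b)
    (haR : a ≤ R) (hbR : b ≤ R) :
    s * |Real.log b - Real.log a| ≤ |Real.log (Φ b) - Real.log (Φ a)| + K := by
  rcases le_total a b with h | h
  · have h₁ := hΦ.lower a b ha h hbR
    rw [Real.log_div hb.ne' ha.ne'] at h₁
    rw [abs_of_nonneg (sub_nonneg.2 (Real.log_le_log ha h))]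
    linarith [neg_abs_le (Real.log (Φ b) - Real.log (Φ a))]
  · have h₁ := hΦ.lower b a hb h haR
    rw [Real.log_div ha.ne' hb.ne'] at h₁
    rw [abs_of_nonpos (sub_nonpos.2 (Real.log_le_log hb h))]
    linarith [le_abs_self (Real.log (Φ b) - Real.log (Φ a))]

/-- `log Ψ(b)` is close to `log Φ(a)` through the common sum, and `log Φ(a)` to `log Ψ(a)` by
`hlim`, with relative errors. Lower regularity turns closeness of `log Ψ(b)` and `log Ψ(a)` into
closeness of `log b` and `log a`. -/
theorem eventually_abs_log_div_sub_one_lt (hΦ : IsRegular Φ s K R) (hΨ : IsRegular Ψ s' K' R')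
    (hlim : Tendsto (fun r => Real.log (Φ r) / Real.log (Ψ r)) (𝓝[>] 0) (𝓝 1))
    {L L' : ℝ} (hL : 0 < L) {ε : ℝ} (hε : 0 < ε) :
    ∀ᶠ a in 𝓝[>] (0 : ℝ), ∀ b, 0 < b → ∀ j : ℕ,
      |Real.log (Φ a) - ∑ i ∈ Finset.range j, (i : ℝ) * Real.log 2| ≤ L * (j + 1) →
      |Real.log (Ψ b) - ∑ i ∈ Finset.range j, (i : ℝ) * Real.log 2| ≤ L' * (j + 1) →
      |Real.log b / Real.log a - 1| < ε := by
  have hs' := hΨ.s_pos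
  have hK := hΦ.K_pos
  set η := min (1 / 2) (ε * s' / (16 * K)) with hη
  have hηpos : 0 < η := lt_min (by norm_num) (by positivity)
  have hη₁ : η ≤ 1 / 2 := min_le_left _ _
  have hη₂ : η * (16 * K) ≤ ε * s' := by
    rw [← le_div_iff₀ (by positivity)]
    exact min_le_right _ _
  obtain ⟨A₀, hA₀⟩ := exists_forall_abs_sub_le (L' := L') hηpos hL
  filter_upwards [eventually_le_nhdsGT_zero hΨ.R_pos, self_mem_nhdsWithin,
    hΦ.tendsto_log.eventually_gt_atTop A₀, hΦ.eventually_log_le,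
    hΦ.tendsto_log.eventually_gt_atTop (2 * Real.log (Ψ R')),
    hΨ.tendsto_log.eventually_gt_atTop 0,
    tendsto_neg_log_nhdsGT_zero.eventually_gt_atTop (2 * K' / (ε * s')),
    tendsto_neg_log_nhdsGT_zero.eventually_gt_atTop 0,
    Metric.tendsto_nhds.1 hlim (η / 2) (half_pos hηpos)] with a haR ha hA hAK hAR hΨpos ha'
    ha'' hrat
  intro b hb j h₁ h₂
  have h₃ := hA₀ _ _ j hA h₁ h₂
  have ha0 : 0 < a := ha
  -- Lower regularity of `Ψ` holds only up to `R'`. A larger `b` would give a bounded `log (Ψ b)`,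
  -- whereas it is at least half of `log (Φ a)`.
  have hbR : b ≤ R' := by
    by_contra hlt
    have h₄ := Real.log_le_log (hΨ.pos _) (hΨ.anti R' b hΨ.R_pos (not_le.1 hlt).le)
    have h₅ := (abs_le.1 h₃).2
    have h₆ := hΨ.log_nonneg R'
    nlinarith
  have h₄ : |Real.log (Φ a) - Real.log (Ψ a)| ≤ η * Real.log (Φ a) := by
    rw [Real.dist_eq, div_sub_one hΨpos.ne', abs_div, abs_of_pos hΨpos, div_lt_iff₀ hΨpos] at hrat
    have h₅ := (abs_lt.1 hrat).1
    have h₆ : Real.log (Ψ a) ≤ 2 * Real.log (Φ a) := by nlinarith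
    have h₇ := mul_le_mul_of_nonneg_left h₆ hηpos.le
    linarith
  have h₅ := hΨ.mul_abs_log_sub_le ha0 hb haR hbR
  have h₆ : |Real.log (Ψ b) - Real.log (Ψ a)| ≤ 2 * (η * Real.log (Φ a)) := by
    rw [abs_le] at h₃ h₄ ⊢
    constructor <;> linarith
  have h₇ := mul_le_mul_of_nonneg_left hAK hηpos.le
  have h₈ := mul_le_mul_of_nonneg_right hη₂ ha''.le
  rw [div_lt_iff₀ (by positivity)] at ha'
  have hlog : Real.log a < 0 := by linarith
  have hne : Real.log a ≠ 0 := hlog.ne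
  rw [div_sub_one hne, abs_div, abs_of_neg hlog, div_lt_iff₀ ha'']
  have h₉ : s' * |Real.log b - Real.log a| < s' * (ε * -Real.log a) := by
    have : 0 < ε * s' * -Real.log a := by positivity
    linarith
  exact lt_of_mul_lt_mul_left h₉ hs'.le

/-- Passing from `r` to `r ^ (1 + t)` adds about `K * t * |log r|`, at most half of `η * log (Φ r)`
because `log (Φ r) ≥ (s / 2) * |log r|`. The other half absorbs the constants. -/
theorem IsRegular.exists_eventually_rpow_le (hΦ : IsRegular Φ s K R) {η : ℝ} (hη : 0 < η) :
    ∃ t₀ : ℝ, 0 < t₀ ∧ ∀ t, 0 < t → t ≤ t₀ → ∀ c : ℝ, ∀ᶠ r in 𝓝[>] (0 : ℝ),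
      c + Real.log (Φ (r ^ (1 + t) / 3)) ≤ (1 + η) * Real.log (Φ r) := by
  have hs := hΦ.s_pos
  have hK := hΦ.K_pos
  refine ⟨η * s / (4 * K), by positivity, ?_⟩
  intro t ht htle c
  rw [le_div_iff₀ (by positivity)] at htle
  filter_upwards [self_mem_nhdsWithin, eventually_le_nhdsGT_zero one_pos, hΦ.eventually_le_log,
    (hΦ.tendsto_log.const_mul_atTop (half_pos hη)).eventually_ge_atTop
      (c + K * (1 + Real.log 3) + K),
    tendsto_neg_log_nhdsGT_zero.eventually_gt_atTop 0] with r hr hr1 hlow hbig hneg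
  have hr0 : 0 < r := hr
  have hle : r ^ (1 + t) ≤ r := by
    conv_rhs => rw [← Real.rpow_one r]
    exact Real.rpow_le_rpow_of_exponent_ge hr0 hr1 (by linarith)
  have hp : 0 < r ^ (1 + t) := Real.rpow_pos_of_pos hr0 _
  have h₁ := hΦ.log_div_le (a := 3) (by norm_num) hp
  have h₂ := hΦ.upper _ r hp hle
  rw [Real.log_div hr0.ne' hp.ne', Real.log_rpow hr0] at h₂
  have h₃ := mul_le_mul_of_nonneg_right htle hneg.le
  have h₄ := mul_le_mul_of_nonneg_left hlow hη.le
  linarith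

theorem tendsto_div_of_eventually_le {ι : Type*} {l : Filter ι} {f g : ι → ℝ}
    (hg : ∀ᶠ i in l, 0 < g i)
    (h₁ : ∀ η > 0, ∀ᶠ i in l, f i ≤ (1 + η) * g i)
    (h₂ : ∀ η > 0, ∀ᶠ i in l, g i ≤ (1 + η) * f i) :
    Tendsto (fun i => f i / g i) l (𝓝 1) := by
  rw [Metric.tendsto_nhds]
  intro ε hε
  filter_upwards [hg, h₁ (ε / 2) (half_pos hε), h₂ (ε / 2) (half_pos hε)] with i hgi hi₁ hi₂
  rw [Real.dist_eq, div_sub_one hgi.ne', abs_div, abs_of_pos hgi, div_lt_iff₀ hgi, abs_lt]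
  constructor
  · have hf : 0 < f i := pos_of_mul_pos_right (hgi.trans_le hi₂) (by positivity)
    rcases le_total (f i) (g i) with h | h
    · have := mul_le_mul_of_nonneg_left h (half_pos hε).le
      have := mul_pos hε hgi
      linarith
    · have := mul_pos hε hgi
      linarith
  · have := mul_pos hε hgi
    linarith

end Asymptotics

/-! ### Quasi-Lipschitz equivalence and the gauges. -/

section QuasiLipschitz

variable {X Y : Type*} [MetricSpace X] [MeasurableSpace X] [BorelSpace X] {μ : Measure X}
  [IsProbabilityMeasure μ] {Φ : ℝ → ℝ} {C s K R : ℝ} [MetricSpace Y] [MeasurableSpace Y]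
  [BorelSpace Y] {ν : Measure Y} [IsProbabilityMeasure ν] {Ψ : ℝ → ℝ} {C' s' K' R' : ℝ}

theorem quasiLipschitzEquivalent_of_tendsto [CompactSpace X] [CompactSpace Y] (hC : 1 ≤ C)
    (hC' : 1 ≤ C') (hμ : IsGauge μ Φ C) (hΦ : IsRegular Φ s K R) (hν : IsGauge ν Ψ C')
    (hΨ : IsRegular Ψ s' K' R') {C₁ R₁ C₂ R₂ : ℝ} (hC₁ : 1 < C₁) (hR₁ : 0 < R₁)
    (hX : HasSmallCells X C₁ R₁) (hC₂ : 1 < C₂) (hR₂ : 0 < R₂) (hY : HasSmallCells Y C₂ R₂)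
    (hlim : Tendsto (fun r => Real.log (Φ r) / Real.log (Ψ r)) (𝓝[>] 0) (𝓝 1)) :
    QuasiLipschitzEquivalent X Y := by
  obtain ⟨N, D, B, hN⟩ := hμ.exists_isSplitSystem hC hΦ hC₁ hR₁ hX
  obtain ⟨N', D', B', hN'⟩ := hν.exists_isSplitSystem hC' hΨ hC₂ hR₂ hY
  obtain ⟨e, L, hL, he⟩ := hN.exists_coding
  obtain ⟨e', L', -, he'⟩ := hN'.exists_coding
  refine ⟨e.trans e'.symm, (e.trans e'.symm).bijective, fun ε hε => ?_⟩
  obtain ⟨δ, hδ, hev⟩ := (nhdsGT_basis (0 : ℝ)).eventually_iff.1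
    (eventually_abs_log_div_sub_one_lt hΦ hΨ hlim hL hε)
  refine ⟨δ, hδ, fun x y hne hdist => ?_⟩
  have hex : ∃ j, e x j ≠ e y j := Function.ne_iff.1 (e.injective.ne hne)
  classical
  have h₁ : ∀ i < Nat.find hex, e x i = e y i := fun i hi => not_not.1 (Nat.find_min hex hi)
  have h₂ := Nat.find_spec hex
  refine hev ⟨dist_pos.2 hne, hdist⟩ _ (dist_pos.2 ((e.trans e'.symm).injective.ne hne))
    (Nat.find hex) (he x y _ h₁ h₂) (he' _ _ _ ?_ ?_)
  · simpa using h₁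
  · simpa using h₂

/-- One half of the comparison of the gauges of quasi-Lipschitz equivalent spaces: separated sets
in the domain stay separated. -/
theorem eventually_log_le_of_forward (hC : 1 ≤ C) (hμ : IsGauge μ Φ C) (hΦ : IsRegular Φ s K R)
    (hν : IsGauge ν Ψ C') (hΨ : IsRegular Ψ s' K' R') [Nonempty X] {f : X → Y}
    (hf : Function.Injective f)
    (hlog : ∀ ε : ℝ, 0 < ε → ∃ δ : ℝ, 0 < δ ∧ ∀ x₁ x₂ : X, x₁ ≠ x₂ → dist x₁ x₂ < δ →
      |Real.log (dist (f x₁) (f x₂)) / Real.log (dist x₁ x₂) - 1| < ε) {η : ℝ} (hη : 0 < η) :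
    ∀ᶠ r in 𝓝[>] (0 : ℝ), Real.log (Φ r) ≤ (1 + η) * Real.log (Ψ r) := by
  classical
  obtain ⟨t, ht, htev⟩ := hΨ.exists_eventually_rpow_le hη
  obtain ⟨δ₀, hδ₀, hδ⟩ := hlog t ht
  -- Points in a ball of radius `δ / 3` are pairwise closer than `δ`, so `hlog` applies to all pairs
  -- and their log-distances are negative. Restricting to this ball of fixed mass `m` costs only a
  -- constant.
  set δ := min δ₀ 1 with hδdef
  have hδpos : 0 < δ := lt_min hδ₀ one_pos
  let x₀ : X := Classical.arbitrary X
  set m := μ.real (Metric.closedBall x₀ (δ / 3)) with hm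
  have hmpos : 0 < m := pos_of_mul_pos_right
    (one_pos.trans_le (hμ.lower x₀ (δ / 3) (by positivity))) (hΦ.pos _).le
  filter_upwards [self_mem_nhdsWithin, htev t ht le_rfl (Real.log C - Real.log m)] with r hr hrev
  have hr0 : 0 < r := hr
  obtain ⟨T, hT, hsep, hcard⟩ := hμ.exists_separated hΦ x₀ (δ / 3) hr0
  have hp : 0 < r ^ (1 + t) := Real.rpow_pos_of_pos hr0 _
  have hcard' := hν.card_le hΨ (T.image f) hp ?_
  · rw [Finset.card_image_of_injective _ hf] at hcard'
    have p₁ := hΦ.pos r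
    have p₂ := hΨ.pos (r ^ (1 + t) / 3)
    have h₁ : Φ r * m ≤ C * Ψ (r ^ (1 + t) / 3) :=
      hcard.trans (mul_le_mul_of_nonneg_left hcard' (by linarith))
    have h₂ := Real.log_le_log (by positivity) h₁
    rw [Real.log_mul p₁.ne' hmpos.ne', Real.log_mul (by positivity) p₂.ne'] at h₂
    linarith
  · intro y hy z hz hyz
    obtain ⟨x, hx, rfl⟩ := Finset.mem_image.1 hy
    obtain ⟨x', hx', rfl⟩ := Finset.mem_image.1 hz
    have hne : x ≠ x' := fun h => hyz (by rw [h])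
    have hd : dist x x' < δ := by
      linarith [dist_triangle_right x x' x₀, hT x hx, hT x' hx']
    have h₁ := (abs_lt.1 (hδ x x' hne (hd.trans_le (min_le_left _ _)))).2
    have hneg : Real.log (dist x x') < 0 :=
      Real.log_neg (dist_pos.2 hne) (hd.trans_le (min_le_right _ _))
    have h₂ : Real.log (dist (f x) (f x')) / Real.log (dist x x') < 1 + t := by linarith
    rw [div_lt_iff_of_neg hneg] at h₂
    have h₃ := Real.log_le_log hr0 (hsep x hx x' hx' hne)
    rw [← Real.log_le_log_iff hp (dist_pos.2 hyz), Real.log_rpow hr0]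
    have h₄ := mul_le_mul_of_nonneg_left h₃ (by linarith : 0 ≤ 1 + t)
    linarith

/-- The other half: separated sets in the image come from separated sets. -/
theorem eventually_log_le_of_backward [CompactSpace Y] (hC' : 1 ≤ C') (hμ : IsGauge μ Φ C)
    (hΦ : IsRegular Φ s K R) (hν : IsGauge ν Ψ C') (hΨ : IsRegular Ψ s' K' R') [Nonempty Y]
    {f : X → Y} (hf : Function.Bijective f)
    (hlog : ∀ ε : ℝ, 0 < ε → ∃ δ : ℝ, 0 < δ ∧ ∀ x₁ x₂ : X, x₁ ≠ x₂ → dist x₁ x₂ < δ →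
      |Real.log (dist (f x₁) (f x₂)) / Real.log (dist x₁ x₂) - 1| < ε) {η : ℝ} (hη : 0 < η) :
    ∀ᶠ r in 𝓝[>] (0 : ℝ), Real.log (Ψ r) ≤ (1 + η) * Real.log (Φ r) := by
  classical
  obtain ⟨t₀, ht₀, htev⟩ := hΦ.exists_eventually_rpow_le hη
  set t := min t₀ 1 with htdef
  have ht : 0 < t := lt_min ht₀ one_pos
  have ht1 : t ≤ 1 := min_le_right _ _
  -- The tolerance `t / 4` is chosen so that `(1 - t / 4) * (1 + t) > 1` for `0 < t ≤ 1`: preimages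
  -- closer than `r ^ (1 + t)` would have images closer than `r`.
  obtain ⟨δ, hδpos, hδ⟩ := hlog (t / 4) (by positivity)
  let y₀ : Y := Classical.arbitrary Y
  have hball : Metric.closedBall y₀ (Metric.diam (Set.univ : Set Y)) = Set.univ :=
    Set.eq_univ_of_forall fun z =>
      Metric.dist_le_diam_of_mem isCompact_univ.isBounded (Set.mem_univ _) (Set.mem_univ _)
  filter_upwards [self_mem_nhdsWithin, htev t ht (min_le_left _ _) (Real.log C'),
    eventually_le_nhdsGT_zero (lt_min hδpos (by norm_num : (0 : ℝ) < 1 / 2))] with r hr hrev hrδ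
  have hr0 : 0 < r := hr
  have hr1 : r < 1 := (hrδ.trans (min_le_right _ _)).trans_lt (by norm_num)
  have hlogr : Real.log r < 0 := Real.log_neg hr0 hr1
  obtain ⟨T, -, hsep, hcard⟩ := hν.exists_separated hΨ y₀ (Metric.diam (Set.univ : Set Y)) hr0
  rw [hball, probReal_univ, mul_one] at hcard
  have hp : 0 < r ^ (1 + t) := Real.rpow_pos_of_pos hr0 _
  have hple : r ^ (1 + t) ≤ r := by
    conv_rhs => rw [← Real.rpow_one r]
    exact Real.rpow_le_rpow_of_exponent_ge hr0 hr1.le (by linarith)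
  let e := Equiv.ofBijective f hf
  have hfe : ∀ y, f (e.symm y) = y := fun y => e.apply_symm_apply y
  have hcard' := hμ.card_le hΦ (T.image e.symm) hp ?_
  · rw [Finset.card_image_of_injective _ e.symm.injective] at hcard'
    have p₁ := hΨ.pos r
    have p₂ := hΦ.pos (r ^ (1 + t) / 3)
    have h₁ : Ψ r ≤ C' * Φ (r ^ (1 + t) / 3) :=
      hcard.trans (mul_le_mul_of_nonneg_left hcard' (by linarith))
    have h₂ := Real.log_le_log (by positivity) h₁
    rw [Real.log_mul (by positivity) p₂.ne'] at h₂
    linarith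
  · intro x hx x' hx' hne
    obtain ⟨y, hy, rfl⟩ := Finset.mem_image.1 hx
    obtain ⟨y', hy', rfl⟩ := Finset.mem_image.1 hx'
    have hyne : y ≠ y' := fun h => hne (by rw [h])
    by_contra hlt
    rw [not_le] at hlt
    have hd : dist (e.symm y) (e.symm y') < δ :=
      (hlt.trans_le hple).trans_le (hrδ.trans (min_le_left _ _))
    have h₁ := (abs_lt.1 (hδ _ _ hne hd)).1
    rw [hfe, hfe] at h₁
    have hlog₁ : Real.log (dist (e.symm y) (e.symm y')) < (1 + t) * Real.log r := by
      rw [← Real.log_rpow hr0]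
      exact Real.log_lt_log (dist_pos.2 hne) hlt
    have hneg : Real.log (dist (e.symm y) (e.symm y')) < 0 :=
      hlog₁.trans (mul_neg_of_pos_of_neg (by linarith) hlogr)
    have h₂ : 1 - t / 4 <
        Real.log (dist y y') / Real.log (dist (e.symm y) (e.symm y')) := by linarith
    rw [lt_div_iff_of_neg hneg] at h₂
    have h₃ := Real.log_le_log hr0 (hsep y hy y' hy' hyne)
    have h₄ := mul_lt_mul_of_pos_left hlog₁ (by linarith : 0 < 1 - t / 4)
    have h₅ : 0 < (3 * t / 4 - t * t / 4) * -Real.log r := by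
      refine mul_pos ?_ (by linarith)
      nlinarith
    linarith

theorem QuasiLipschitzEquivalent.tendsto [CompactSpace Y] (hC : 1 ≤ C) (hC' : 1 ≤ C')
    (hμ : IsGauge μ Φ C) (hΦ : IsRegular Φ s K R) (hν : IsGauge ν Ψ C')
    (hΨ : IsRegular Ψ s' K' R') (h : QuasiLipschitzEquivalent X Y) :
    Tendsto (fun r => Real.log (Φ r) / Real.log (Ψ r)) (𝓝[>] 0) (𝓝 1) := by
  obtain ⟨f, hf, hlog⟩ := h
  have hX : Nonempty X := by
    by_contra hcon
    rw [not_nonempty_iff] at hcon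
    exact IsProbabilityMeasure.ne_zero μ (Measure.eq_zero_of_isEmpty μ)
  have hY : Nonempty Y := hX.map f
  exact tendsto_div_of_eventually_le (hΨ.tendsto_log.eventually_gt_atTop 0)
    (fun η hη => eventually_log_le_of_forward hC hμ hΦ hν hΨ hf.1 hlog hη)
    (fun η hη => eventually_log_le_of_backward hC' hμ hΦ hν hΨ hf hlog hη)

end QuasiLipschitz

/-! ### The supremum condition and the final assembly. -/

theorem exists_gap_of_iSup_lt_one {p q : ℕ} {J : Set (EuclideanSpace ℝ (Fin p))} {n : ℕ → ℕ}
    {c : ℕ → ℝ} {I : Set (EuclideanSpace ℝ (Fin q))} {m : ℕ → ℕ} {d : ℕ → ℝ} {s L R s' L' R' : ℝ}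
    (hΦ : IsRegular (Phi J n c) s L R) (hΨ : IsRegular (Phi I m d) s' L' R') {r₀ : ℝ}
    (hr₀ : 0 < r₀)
    (h : (⨆ s ∈ {s : ℝ × ℝ | 0 < s.2 ∧ s.2 < r₀ * s.1 ∧ s.1 < r₀},
          ((Real.log (Phi₂ J n c s.1 s.2) / Real.log (Phi₂ I m d s.1 s.2) : ℝ) : EReal)) < 1) :
    ∃ θ r₁ α : ℝ, 0 < θ ∧ 0 < r₁ ∧ α < 1 ∧ ∀ r r', 0 < r' → r' < θ * r → r < r₁ →
      Real.log (Phi J n c r') - Real.log (Phi J n c r) ≤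
        α * (Real.log (Phi I m d r') - Real.log (Phi I m d r)) := by
  obtain ⟨α, hα, hα₁⟩ := EReal.lt_iff_exists_real_btwn.1 h
  have hs' := hΨ.s_pos
  have hL' := hΨ.K_pos
  -- For `r' < exp (-(L' / s')) * r` lower regularity makes the denominator of the quotient strictly
  -- positive, so the bound on the quotient may be multiplied out.
  refine ⟨min r₀ (Real.exp (-(L' / s'))), min r₀ R', α, lt_min hr₀ (Real.exp_pos _),
    lt_min hr₀ hΨ.R_pos, by exact_mod_cast hα₁, ?_⟩
  intro r r' hr' hlt hr
  have hr0 : 0 < r := by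
    have h₁ : 0 < min r₀ (Real.exp (-(L' / s'))) := lt_min hr₀ (Real.exp_pos _)
    exact pos_of_mul_pos_right (hr'.trans hlt) h₁.le
  have h₁ : r' < r₀ * r := hlt.trans_le (mul_le_mul_of_nonneg_right (min_le_left _ _) hr0.le)
  have h₂ : r' < Real.exp (-(L' / s')) * r :=
    hlt.trans_le (mul_le_mul_of_nonneg_right (min_le_right _ _) hr0.le)
  have h₃ : ((Real.log (Phi₂ J n c r r') / Real.log (Phi₂ I m d r r') : ℝ) : EReal) ≤ α :=
    (le_iSup₂_of_le (f := fun (s : ℝ × ℝ)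
      (_ : s ∈ {s : ℝ × ℝ | 0 < s.2 ∧ s.2 < r₀ * s.1 ∧ s.1 < r₀}) =>
        ((Real.log (Phi₂ J n c s.1 s.2) / Real.log (Phi₂ I m d s.1 s.2) : ℝ) : EReal))
      (r, r') ⟨hr', h₁, hr.trans_le (min_le_left _ _)⟩ le_rfl).trans hα.le
  rw [EReal.coe_le_coe_iff, Phi₂, Phi₂, Real.log_div (hΦ.pos _).ne' (hΦ.pos _).ne',
    Real.log_div (hΨ.pos _).ne' (hΨ.pos _).ne'] at h₃
  have hexp : Real.exp (-(L' / s')) ≤ 1 := Real.exp_le_one_iff.2 (by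
    have : 0 ≤ L' / s' := by positivity
    linarith)
  have hle : r' ≤ r := h₂.le.trans (mul_le_of_le_one_left hr0.le hexp)
  have h₄ := hΨ.lower r' r hr' hle (hr.le.trans (min_le_right _ _))
  have h₅ := Real.log_lt_log hr' h₂
  rw [Real.log_mul (Real.exp_pos _).ne' hr0.ne', Real.log_exp] at h₅
  rw [Real.log_div hr0.ne' hr'.ne'] at h₄
  have h₆ : L' / s' < Real.log r - Real.log r' := by linarith
  rw [div_lt_iff₀ hs'] at h₆
  have hpos : 0 < Real.log (Phi I m d r') - Real.log (Phi I m d r) := by linarith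
  rwa [div_le_iff₀ hpos] at h₃

end Moran

end

theorem mainTheorem9
    {p q : ℕ}
    (J : Set (EuclideanSpace ℝ (Fin p))) (n : ℕ → ℕ) (c : ℕ → ℝ) (hA : Moran.IsData J n c)
    (I : Set (EuclideanSpace ℝ (Fin q))) (m : ℕ → ℕ) (d : ℕ → ℝ) (hB : Moran.IsData I m d) :
    (∀ k₀ : ℕ, 1 ≤ k₀ →
      limsup (fun k : ℕ =>
        ((Real.log (∏ i ∈ Finset.range k₀, (n (k + i) : ℝ)) /
          -Real.log (∏ i ∈ Finset.range k₀, c (k + i)) : ℝ) : EReal)) atTop < 1 →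
      ∀ E ∈ Moran.MoranClass J n c, Moran.UniformlyDisconnected E) ∧
    (∀ E ∈ Moran.MoranClass J n c, Moran.UniformlyDisconnected E →
      (∃ r₀ : ℝ, 0 < r₀ ∧ r₀ < 1 ∧
        (⨆ s ∈ {s : ℝ × ℝ | 0 < s.2 ∧ s.2 < r₀ * s.1 ∧ s.1 < r₀},
          ((Real.log (Moran.Phi₂ J n c s.1 s.2) /
            Real.log (Moran.Phi₂ I m d s.1 s.2) : ℝ) : EReal)) < 1) →
      ∀ F ∈ Moran.MoranClass I m d, Moran.BilipschitzEmbeds E F) ∧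
    (∀ E ∈ Moran.MoranClass J n c, ∀ F ∈ Moran.MoranClass I m d,
      Moran.UniformlyDisconnected E → Moran.UniformlyDisconnected F →
      (Moran.QuasiLipschitzEquivalent E F ↔
        Tendsto (fun r : ℝ => Real.log (Moran.Phi J n c r) / Real.log (Moran.Phi I m d r))
          (𝓝[>] 0) (𝓝 1))) := by
  refine ⟨?_, ?_, ?_⟩
  · rintro k₀ hk₀ hlim E ⟨K, hK, rfl⟩
    obtain ⟨s, L, hΦ⟩ := hK.exists_isRegular hA
    obtain ⟨μ, C, hμp, hC, hμ⟩ := hK.exists_isGauge hA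
    obtain ⟨σ, L', R, hσ, hσ₁, hR, hgrow⟩ := hK.exists_growth hA hk₀ hlim
    change Moran.UniformlyDisconnected (Moran.limitSet n K)
    exact Moran.uniformlyDisconnected_of_growth hC hμ hΦ hσ hσ₁ hR hgrow
  · rintro E ⟨K, hK, rfl⟩ hE ⟨r₀, hr₀, -, hsup⟩ F ⟨K', hK', rfl⟩
    obtain ⟨s, L, hΦ⟩ := hK.exists_isRegular hA
    obtain ⟨μ, C, hμp, hC, hμ⟩ := hK.exists_isGauge hA
    obtain ⟨s', L', hΨ⟩ := hK'.exists_isRegular hB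
    obtain ⟨ν, C', hνp, hC', hν⟩ := hK'.exists_isGauge hB
    have := isCompact_iff_compactSpace.1 (hK.isCompact_limitSet hA)
    have := isCompact_iff_compactSpace.1 (hK'.isCompact_limitSet hB)
    obtain ⟨C₁, R₁, hC₁, hR₁, hcell⟩ := hE.hasSmallCells
    obtain ⟨θ, r₁, α, hθ, hr₁, hα, hgap⟩ := Moran.exists_gap_of_iSup_lt_one hΦ hΨ hr₀ hsup
    change Moran.BilipschitzEmbeds (Moran.limitSet n K) (Moran.limitSet m K')
    exact Moran.bilipschitzEmbeds_of_gauge hC hC' hμ hΦ hν hΨ hC₁ hR₁ hcell hθ hr₁ hα hgap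
  · rintro E ⟨K, hK, rfl⟩ F ⟨K', hK', rfl⟩ hE hF
    obtain ⟨s, L, hΦ⟩ := hK.exists_isRegular hA
    obtain ⟨μ, C, hμp, hC, hμ⟩ := hK.exists_isGauge hA
    obtain ⟨s', L', hΨ⟩ := hK'.exists_isRegular hB
    obtain ⟨ν, C', hνp, hC', hν⟩ := hK'.exists_isGauge hB
    have := isCompact_iff_compactSpace.1 (hK.isCompact_limitSet hA)
    have := isCompact_iff_compactSpace.1 (hK'.isCompact_limitSet hB)
    obtain ⟨C₁, R₁, hC₁, hR₁, hcell⟩ := hE.hasSmallCells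
    obtain ⟨C₂, R₂, hC₂, hR₂, hcell'⟩ := hF.hasSmallCells
    change Moran.QuasiLipschitzEquivalent (Moran.limitSet n K) (Moran.limitSet m K') ↔ _
    exact ⟨fun h => h.tendsto hC hC' hμ hΦ hν hΨ, fun h =>
      Moran.quasiLipschitzEquivalent_of_tendsto hC hC' hμ hΦ hν hΨ hC₁ hR₁ hcell hC₂ hR₂ hcell' h⟩
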